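/- \textbf{Conventions.} Manifolds are smooth Hausdorff manifolds modeled on Hausdorff locally convex real vector spaces, where the model space may vary from chart to chart; smoothness is in the sense of Michal--Bastiani (all iterated directional derivatives exist and are continuous). A subset $N$ of a manifold $M$ is a submanifold if around each of its points there is a chart of $M$ in which $N$ corresponds to a closed linear subspace of the model space; a closed submanifold is a submanifold that is a closed subset. For an action of $G$ on $M$, the orbit type of $m$ is the conjugacy class $(G_m)$ of its stabilizer; $(H)\le (K)$ means that some representative of $(H)$ is contained in some representative of $(K)$. For $N\subseteq M$, $N_{(H)}$ is the set of points of $N$ of orbit type $(H)$. The action is proper if preimages of compact sets under $G\times M\to M\times M$, $(g,m)\mapsto (g\cdot m,m)$, are compact. A \emph{slice} at $m\in M$ is a submanifold $S\ni m$ of $M$ such that (SL1) $G_m\cdot S\subseteq S$; (SL2) if $g\cdot S\cap S\ne\emptyset$, then $g\in G_m$; (SL3) $G_m$ is a Lie subgroup of $G$ for which $G\to G/G_m$ is a smooth principal $G_m$-bundle, and this bundle has a smooth local section $\chi:U\to G$ on an open neighborhood $U$ of the identity coset such that $U\times S\to M$, $([g],s)\mapsto \chi([g])\cdot s$, is a diffeomorphism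 onto an open neighborhood of $m$; (SL4) $S_{(G_m)}$ is a closed submanifold of $S$. A \emph{stratification} of a Hausdorff space $Y$ is a partition of $Y$ into non-empty subsets $Y_\sigma$ such that every $Y_\sigma$ is locally closed and is a manifold with respect to the relative topology, and such that for every pair of disjoint pieces with $Y_\varsigma\cap\overline{Y_\sigma}\neq\emptyset$ one has $Y_\varsigma\subseteq\overline{Y_\sigma}\setminus Y_\sigma$ and $Y_\sigma\cap\overline{Y_\varsigma}=\emptyset$. \textbf{Proposition.} Let $G$ be a Lie group acting smoothly and properly on a manifold $M$, and let $X\subseteq M$ be a closed $G$-invariant subset. Assume that at every point $m\in X$ the action on $M$ admits a slice $S$ such that \begin{enumerate} \item $X\cap S_{(G_m)}$ is a closed submanifold of $S_{(G_m)}$; \item for every orbit type $(K)\le (G_m)$ occurring in $X$, the point $m$ lies in the closure of $S_{(K)}\cap X$ in $S$. \end{enumerate} Then the partition of $X$ into the orbit type subsets $X_{(H)}=X\cap M_{(H)}$, with $(H)$ running through the orbit types occurring in $X$, is a stratification, where $X_{(H)}$ carries the smooth structure induced from $M$: the inclusion $X_{(H)}\to M$ is smooth, and a map from a manifold to $X_{(H)}$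 is smooth if its composition with this inclusion is smooth. If, moreover, the topology of $M\times M$ is compactly generated (for example, if $M$ is a Fréchet manifold), then the partition of $X/G$ (with the quotient topology) into the subsets $X_{(H)}/G$ is a stratification, too, for smooth structures on the pieces $X_{(H)}/G$ that make the projections $X_{(H)}\to X_{(H)}/G$ smooth submersions (maps that in suitable charts are projections onto a factor of a product). -/

import Mathlib

open Set Filter Topology

universe u v w u₁ u₂

/-! ## Differential calculus on locally convex spaces -/

/-- `f : E ⊇ U → F` is of class `C^k` on the open set `U` in the sense of Michal and Bastiani:
`f` is continuous and, for `k ≥ 1`, all directional derivatives `df (x, h)`, `x ∈ U`, `h ∈ E`,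
exist and `df : U × E → F` is of class `C^(k-1)`. -/
def BastianiC : ℕ → ∀ {E F : Type w} [AddCommGroup E] [Module ℝ E] [TopologicalSpace E]
    [AddCommGroup F] [Module ℝ F] [TopologicalSpace F], (E → F) → Set E → Prop
  | 0, _, _, _, _, _, _, _, _, f, U => ContinuousOn f U
  | k + 1, E, F, _, _, _, _, _, _, f, U =>
      ContinuousOn f U ∧
      ∃ df : E × E → F,
        (∀ x ∈ U, ∀ h : E,
          Tendsto (fun t : ℝ => t⁻¹ • (f (x + t • h) - f x)) (𝓝[≠] 0) (𝓝 (df (x, h)))) ∧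
        BastianiC k df (U ×ˢ univ)

/-- Smooth maps on an open subset of a locally convex space. -/
def BastianiSmooth {E F : Type w} [AddCommGroup E] [Module ℝ E] [TopologicalSpace E]
    [AddCommGroup F] [Module ℝ F] [TopologicalSpace F] (f : E → F) (U : Set E) : Prop :=
  ∀ k : ℕ, BastianiC k f U

/-! ## Manifolds modeled on locally convex spaces (the model may vary from chart to chart) -/

/-- A chart of `M`: a homeomorphism from an open subset of `M` onto an open subset of a Hausdorff
locally convex real topological vector space. -/
structure LCChart (M : Type u) [TopologicalSpace M] where
  Model : Type w
  [addCommGroup : AddCommGroup Model]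
  [module : Module ℝ Model]
  [topologicalSpace : TopologicalSpace Model]
  [isTopologicalAddGroup : IsTopologicalAddGroup Model]
  [continuousSMul : ContinuousSMul ℝ Model]
  [locallyConvex : LocallyConvexSpace ℝ Model]
  [t2Space : T2Space Model]
  hom : OpenPartialHomeomorph M Model

attribute [instance] LCChart.addCommGroup LCChart.module LCChart.topologicalSpace
  LCChart.isTopologicalAddGroup LCChart.continuousSMul LCChart.locallyConvex LCChart.t2Space

/-- The coordinate change `ψ ∘ φ⁻¹` is smooth on its natural domain. -/
def LCChart.SmoothTransition {M : Type u} [TopologicalSpace M] (φ ψ : LCChart.{u, w} M) : Prop :=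
  BastianiSmooth (ψ.hom ∘ φ.hom.symm) (φ.hom.target ∩ φ.hom.symm ⁻¹' ψ.hom.source)

/-- A collection of charts. -/
abbrev LCAtlas (M : Type u) [TopologicalSpace M] := Set (LCChart.{u, w} M)

/-- The collection of charts `𝓐` turns the topological space `M` into a smooth (Hausdorff)
manifold modeled on locally convex spaces. -/
structure LCAtlas.IsManifold {M : Type u} [TopologicalSpace M] (𝓐 : LCAtlas.{u, w} M) : Prop where
  t2 : T2Space M
  cover : ∀ x : M, ∃ φ ∈ 𝓐, x ∈ φ.hom.source
  compatible : ∀ φ ∈ 𝓐, ∀ ψ ∈ 𝓐, φ.SmoothTransition ψ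

/-- `φ` belongs to the maximal atlas determined by `𝓐`. -/
def LCAtlas.Admits {M : Type u} [TopologicalSpace M] (𝓐 : LCAtlas.{u, w} M)
    (φ : LCChart.{u, w} M) : Prop :=
  ∀ ψ ∈ 𝓐, φ.SmoothTransition ψ ∧ ψ.SmoothTransition φ

/-- The map `f` between manifolds is smooth on the open set `O`. -/
def LCAtlas.SmoothOn {M : Type u₁} {N : Type u₂} [TopologicalSpace M] [TopologicalSpace N]
    (𝓐 : LCAtlas.{u₁, w} M) (𝓑 : LCAtlas.{u₂, w} N) (f : M → N) (O : Set M) : Prop :=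
  ContinuousOn f O ∧ ∀ φ ∈ 𝓐, ∀ ψ ∈ 𝓑,
    BastianiSmooth (ψ.hom ∘ f ∘ φ.hom.symm)
      (φ.hom.target ∩ φ.hom.symm ⁻¹' (O ∩ f ⁻¹' ψ.hom.source))

/-- `f` restricts to a diffeomorphism from the open set `O` onto the open set `V`. -/
def LCAtlas.DiffeoOn {M : Type u₁} {N : Type u₂} [TopologicalSpace M] [TopologicalSpace N]
    (𝓐 : LCAtlas.{u₁, w} M) (𝓑 : LCAtlas.{u₂, w} N) (f : M → N) (O : Set M) (V : Set N) : Prop :=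
  IsOpen O ∧ IsOpen V ∧ MapsTo f O V ∧ 𝓐.SmoothOn 𝓑 f O ∧
    ∃ j : N → M, MapsTo j V O ∧ 𝓑.SmoothOn 𝓐 j V ∧ InvOn j f O V

/-- The product of two charts. -/
def LCChart.prod {M : Type u₁} {N : Type u₂} [TopologicalSpace M] [TopologicalSpace N]
    (φ : LCChart.{u₁, w} M) (ψ : LCChart.{u₂, w} N) : LCChart.{max u₁ u₂, w} (M × N) where
  Model := φ.Model × ψ.Model
  hom := φ.hom.prod ψ.hom

/-- The product manifold. -/
def LCAtlas.prod {M : Type u₁} {N : Type u₂} [TopologicalSpace M] [TopologicalSpace N]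
    (𝓐 : LCAtlas.{u₁, w} M) (𝓑 : LCAtlas.{u₂, w} N) : LCAtlas.{max u₁ u₂, w} (M × N) :=
  {χ | ∃ φ ∈ 𝓐, ∃ ψ ∈ 𝓑, χ = φ.prod ψ}

/-! ## Submanifolds -/

open Classical in
/-- If, in the chart `φ`, the subset `N` corresponds to the linear subspace `F`, then `φ` restricts
to a chart of `N` with values in `F` (`n` is only used as a value outside the domain). -/
noncomputable def LCChart.restrict {M : Type u} [TopologicalSpace M] (φ : LCChart.{u, w} M)
    {N : Set M} (n : N) (F : Submodule ℝ φ.Model) (h : φ.hom.IsImage N (F : Set φ.Model)) :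
    LCChart.{u, w} N where
  Model := F
  hom :=
    { toFun := fun x => if hx : φ.hom x ∈ F then ⟨φ.hom x, hx⟩ else 0
      invFun := fun y => if hy : φ.hom.symm y ∈ N then ⟨φ.hom.symm y, hy⟩ else n
      source := Subtype.val ⁻¹' φ.hom.source
      target := Subtype.val ⁻¹' φ.hom.target
      map_source' := fun x hx => by
        have hF : φ.hom x ∈ F := (h hx).2 x.2
        simpa [hF] using φ.hom.map_source hx
      map_target' := fun y hy => by
        have hN : φ.hom.symm y ∈ N := (h.symm hy).2 y.2
        simpa [hN] using φ.hom.map_target hy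
      left_inv' := fun x hx => by
        have hx' : (x : M) ∈ φ.hom.source := hx
        have hF : φ.hom x ∈ F := (h hx).2 x.2
        simp [hF, φ.hom.left_inv hx']
      right_inv' := fun y hy => by
        have hy' : (y : φ.Model) ∈ φ.hom.target := hy
        have hN : φ.hom.symm y ∈ N := (h.symm hy).2 y.2
        simp [hN, φ.hom.right_inv hy']
      open_source := φ.hom.open_source.preimage continuous_subtype_val
      open_target := φ.hom.open_target.preimage continuous_subtype_val
      continuousOn_toFun := by
        rw [Topology.IsInducing.subtypeVal.continuousOn_iff]
        refine ((φ.hom.continuousOn.comp continuous_subtype_val.continuousOn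
          (fun x hx => hx))).congr ?_
        intro x hx
        have hF : φ.hom x ∈ F := (h hx).2 x.2
        simp [hF]
      continuousOn_invFun := by
        rw [Topology.IsInducing.subtypeVal.continuousOn_iff]
        refine ((φ.hom.symm.continuousOn.comp continuous_subtype_val.continuousOn
          (fun x hx => hx))).congr ?_
        intro y hy
        have hN : φ.hom.symm y ∈ N := (h.symm hy).2 y.2
        simp [hN] }

/-- `N` is a submanifold of `(M, 𝓐)`: near each of its points it corresponds, in a suitable chart of
`M`, to a closed linear subspace of the model space. -/
def LCAtlas.IsSubmanifold {M : Type u} [TopologicalSpace M] (𝓐 : LCAtlas.{u, w} M)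
    (N : Set M) : Prop :=
  ∀ n ∈ N, ∃ φ : LCChart.{u, w} M, 𝓐.Admits φ ∧ n ∈ φ.hom.source ∧
    ∃ F : Submodule ℝ φ.Model, IsClosed (F : Set φ.Model) ∧ φ.hom.IsImage N (F : Set φ.Model)

/-- The manifold structure of a submanifold, given by the restrictions of the adapted charts. -/
def LCAtlas.sub {M : Type u} [TopologicalSpace M] (𝓐 : LCAtlas.{u, w} M) (N : Set M) :
    LCAtlas.{u, w} N :=
  {c | ∃ (φ : LCChart.{u, w} M) (n : N) (F : Submodule ℝ φ.Model)
    (h : φ.hom.IsImage N (F : Set φ.Model)),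
    𝓐.Admits φ ∧ IsClosed (F : Set φ.Model) ∧ c = φ.restrict n F h}

/-- The smooth structure `𝓐` of `Y` is the one induced by the injection `i` into `(M, 𝓜)`: `i` is
smooth, and a map from a manifold to `Y` is smooth as soon as its composition with `i` is. -/
def LCAtlas.IsInducedBy {Y : Type u₁} {M : Type u₂} [TopologicalSpace Y] [TopologicalSpace M]
    (𝓐 : LCAtlas.{u₁, w} Y) (𝓜 : LCAtlas.{u₂, w} M) (i : Y → M) : Prop :=
  Function.Injective i ∧ 𝓐.SmoothOn 𝓜 i univ ∧
    ∀ (N : Type w) [TopologicalSpace N] (𝓒 : LCAtlas.{w, w} N), 𝓒.IsManifold →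
      ∀ f : N → Y, 𝓒.SmoothOn 𝓜 (i ∘ f) univ → 𝓒.SmoothOn 𝓐 f univ

/-- `f` is a submersion: in suitable charts around `x` and `f x` it is a continuous linear map with
a continuous linear right inverse, that is, a projection onto a factor of a product. -/
def LCAtlas.IsSubmersion {M : Type u₁} {N : Type u₂} [TopologicalSpace M] [TopologicalSpace N]
    (𝓐 : LCAtlas.{u₁, w} M) (𝓑 : LCAtlas.{u₂, w} N) (f : M → N) : Prop :=
  ∀ x : M, ∃ (φ : LCChart.{u₁, w} M) (ψ : LCChart.{u₂, w} N),
    𝓐.Admits φ ∧ 𝓑.Admits ψ ∧ x ∈ φ.hom.source ∧ MapsTo f φ.hom.source ψ.hom.source ∧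
    ∃ (L : φ.Model →L[ℝ] ψ.Model) (R : ψ.Model →L[ℝ] φ.Model),
      (∀ y, L (R y) = y) ∧ ∀ z ∈ φ.hom.source, ψ.hom (f z) = L (φ.hom z)

/-! ## Lie groups and Lie group actions -/

/-- `𝓖` turns the group `G` into a Lie group. -/
structure LCAtlas.IsLieGroup {G : Type v} [Group G] [TopologicalSpace G]
    (𝓖 : LCAtlas.{v, w} G) : Prop where
  manifold : 𝓖.IsManifold
  smooth_mul : (𝓖.prod 𝓖).SmoothOn 𝓖 (fun p : G × G => p.1 * p.2) univ
  smooth_inv : 𝓖.SmoothOn 𝓖 (fun g : G => g⁻¹) univ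

/-- The action of `G` on `M` is smooth. -/
def IsSmoothAction {G : Type v} {M : Type u} [Group G] [TopologicalSpace G] [TopologicalSpace M]
    [MulAction G M] (𝓖 : LCAtlas.{v, w} G) (𝓜 : LCAtlas.{u, w} M) : Prop :=
  (𝓖.prod 𝓜).SmoothOn 𝓜 (fun p : G × M => p.1 • p.2) univ

/-- The action is proper: preimages of compact sets under `(g, m) ↦ (g • m, m)` are compact. -/
def IsProperAction (G : Type v) (M : Type u) [Group G] [TopologicalSpace G] [TopologicalSpace M]
    [MulAction G M] : Prop :=
  ∀ K : Set (M × M), IsCompact K → IsCompact ((fun p : G × M => (p.1 • p.2, p.2)) ⁻¹' K)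

/-- `H` is a Lie subgroup of `G` and, with the manifold structure `𝓠` on `G ⧸ H`, the projection
`G → G ⧸ H` is a smooth principal bundle with structure group `H`. -/
structure IsPrincipalLieSubgroup {G : Type v} [Group G] [TopologicalSpace G]
    (𝓖 : LCAtlas.{v, w} G) (H : Subgroup G) (𝓠 : LCAtlas.{v, w} (G ⧸ H)) : Prop where
  submanifold : 𝓖.IsSubmanifold (H : Set G)
  quotient_manifold : 𝓠.IsManifold
  smooth_mk : 𝓖.SmoothOn 𝓠 (fun g : G => (g : G ⧸ H)) univ
  locally_trivial : ∀ q : G ⧸ H, ∃ U : Set (G ⧸ H), q ∈ U ∧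
    ∃ τ : (G ⧸ H) × (H : Set G) → G,
      (𝓠.prod (𝓖.sub (H : Set G))).DiffeoOn 𝓖 τ (U ×ˢ univ) ((fun g : G => (g : G ⧸ H)) ⁻¹' U) ∧
      (∀ q ∈ U, ∀ h : (H : Set G), ((τ (q, h) : G) : G ⧸ H) = q) ∧
      ∀ q ∈ U, ∀ h k : H, τ (q, h * k) = τ (q, h) * (k : G)

/-! ## Orbit types -/

/-- Conjugacy of subgroups. -/
def conjSubgroupSetoid (G : Type v) [Group G] : Setoid (Subgroup G) where
  r H K := ∃ a : G, H.map (MulAut.conj a).toMonoidHom = K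
  iseqv :=
    { refl := fun H => ⟨1, by ext; simp⟩
      symm := by
        rintro H _ ⟨a, rfl⟩
        refine ⟨a⁻¹, ?_⟩
        rw [Subgroup.map_map]
        ext x
        simp [Subgroup.mem_map, mul_assoc]
      trans := by
        rintro H _ _ ⟨a, rfl⟩ ⟨b, rfl⟩
        refine ⟨b * a, ?_⟩
        rw [Subgroup.map_map]
        ext x
        simp [Subgroup.mem_map, mul_assoc] }

/-- Conjugacy classes `(H)` of subgroups of `G`. -/
def OrbitType (G : Type v) [Group G] := Quotient (conjSubgroupSetoid G)

/-- `(H) ≤ (K)`: some representative of `(H)` is contained in some representative of `(K)`. -/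
def OrbitType.le {G : Type v} [Group G] (σ τ : OrbitType G) : Prop :=
  ∃ H K : Subgroup G, Quotient.mk (conjSubgroupSetoid G) H = σ ∧
    Quotient.mk (conjSubgroupSetoid G) K = τ ∧ H ≤ K

/-- The orbit type `(G_m)` of the point `m`. -/
def orbitType (G : Type v) {M : Type u} [Group G] [MulAction G M] (m : M) : OrbitType G :=
  Quotient.mk (conjSubgroupSetoid G) (MulAction.stabilizer G m)

/-- The partial slice `S_(G_m)`, as a subset of `S`. -/
def partialSlice (G : Type v) {M : Type u} [Group G] [MulAction G M] (m : M) (S : Set M) : Set S :=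
  {s | orbitType G (s : M) = orbitType G m}

/-! ## Slices -/

/-- `S` is a slice at `m`. -/
structure IsSlice {G : Type v} {M : Type u} [Group G] [TopologicalSpace G] [TopologicalSpace M]
    [MulAction G M] (𝓖 : LCAtlas.{v, w} G) (𝓜 : LCAtlas.{u, w} M) (m : M) (S : Set M) : Prop where
  submanifold : 𝓜.IsSubmanifold S
  mem : m ∈ S
  invariant : ∀ g ∈ MulAction.stabilizer G m, ∀ s ∈ S, g • s ∈ S
  mem_stabilizer : ∀ g : G, (∃ s ∈ S, g • s ∈ S) → g ∈ MulAction.stabilizer G m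
  locally_product : ∃ 𝓠 : LCAtlas.{v, w} (G ⧸ MulAction.stabilizer G m),
    IsPrincipalLieSubgroup 𝓖 (MulAction.stabilizer G m) 𝓠 ∧
    ∃ (U : Set (G ⧸ MulAction.stabilizer G m)) (χ : G ⧸ MulAction.stabilizer G m → G) (V : Set M),
      ((1 : G) : G ⧸ MulAction.stabilizer G m) ∈ U ∧
      IsOpen U ∧
      𝓠.SmoothOn 𝓖 χ U ∧
      (∀ q ∈ U, ((χ q : G) : G ⧸ MulAction.stabilizer G m) = q) ∧
      m ∈ V ∧
      (𝓠.prod (𝓜.sub S)).DiffeoOn 𝓜 (fun p => χ p.1 • (p.2 : M)) (U ×ˢ univ) V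
  partial_isClosed : IsClosed (partialSlice G m S)
  partial_submanifold : (𝓜.sub S).IsSubmanifold (partialSlice G m S)

/-! ## Stratifications -/

/-- The family of subsets `Z i` with the manifold structures `𝓐 i` is a stratification of the
topological space `Y`. (Since `𝓐 i` is an atlas for the subspace topology, the manifold topology of
each piece is the relative one.) -/
structure IsStratification {Y : Type u₁} [TopologicalSpace Y] {ι : Type u₂} (Z : ι → Set Y)
    (𝓐 : ∀ i, LCAtlas.{u₁, w} (Z i)) : Prop where
  t2 : T2Space Y
  nonempty : ∀ i, (Z i).Nonempty
  disjoint : ∀ i j, i ≠ j → Disjoint (Z i) (Z j)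
  cover : ⋃ i, Z i = univ
  locallyClosed : ∀ i, IsLocallyClosed (Z i)
  manifold : ∀ i, (𝓐 i).IsManifold
  frontier : ∀ i j, Disjoint (Z i) (Z j) → (Z i ∩ closure (Z j)).Nonempty →
    Z i ⊆ closure (Z j) \ Z j ∧ Z j ∩ closure (Z i) = ∅

/-! ## The orbit type pieces of an invariant subset and of its orbit space -/

section Pieces

variable {G : Type v} {M : Type u} [Group G] [MulAction G M]

/-- The orbit types that occur in `X`. -/
def OccurringType (X : SubMulAction G M) := {σ : OrbitType G // ∃ x ∈ X, orbitType G x = σ}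

/-- The piece `X_(H)` of orbit type `σ = (H)` of `X`. -/
def orbitTypePiece (X : SubMulAction G M) (σ : OccurringType X) : Set X :=
  {x | orbitType G (x : M) = σ.1}

/-- The projection of `X` onto its orbit space `X / G`. -/
def toOrbitSpace (X : SubMulAction G M) (x : X) : MulAction.orbitRel.Quotient G X :=
  Quotient.mk (MulAction.orbitRel G X) x

/-- The piece `X_(H) / G` of the orbit space `X / G`. -/
def orbitSpacePiece (X : SubMulAction G M) (σ : OccurringType X) :
    Set (MulAction.orbitRel.Quotient G X) :=
  toOrbitSpace X '' orbitTypePiece X σ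

/-- The projection of `X_(H)` onto `X_(H) / G`. -/
def pieceProjection (X : SubMulAction G M) (σ : OccurringType X) (x : orbitTypePiece X σ) :
    orbitSpacePiece X σ :=
  ⟨toOrbitSpace X x, mem_image_of_mem _ x.2⟩

end Pieces

/-! Near a point `m` of `X_(H)`, a slice `S` identifies a neighbourhood `V` of `m` with `U × S`
through `(q, s) ↦ χ q • s`. Since `X` and the orbit type are `G`-invariant, `V ∩ X_(H)` corresponds
to `U × T` with `T = X ∩ S_(G_m)`, a submanifold by assumption (`IsSlice.nonempty_pieceModel`).
Charts of `U` and `T` together give charts of `X_(H)`; charts of `T` alone give charts of `X_(H) /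
G`, provided that `T` meets every orbit at most once.

By (SL2), that proviso holds once all points of the partial slice have stabilizer `G_m`. There `G_s`
is contained in `G_m` and conjugate to it, while `G_m` is compact by properness. A compact Lie
subgroup is not conjugate to a proper subgroup of itself (`IsLieGroup.map_conj_eq_of_le`): it is
finite-dimensional, conjugation has injective derivative at the identity, so it is open by the
inverse function theorem, hence onto on the identity component and on the finite group of
components.

Smoothness is tested on plots, so that the atlases can be defined by universal conditions: `induced`
for `X_(H)`, `coinduced` for its quotient. The local models only have to show that these atlases
cover.

For the frontier condition, (SL2) bounds the orbit types near `m` by `(G_m)`, and hypothesis 2 puts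
`m` in the closure of each such piece. Local closedness supplies the other half and comes from
(SL4). The orbit space is Hausdorff because the orbit relation is the image of a proper, hence
closed, map. -/

set_option linter.unusedSectionVars false

/-! ## Bastiani calculus -/

section DirectionalDerivatives

variable {E : Type u₁} {F : Type u₂} [AddCommGroup E] [Module ℝ E] [TopologicalSpace E]
  [AddCommGroup F] [Module ℝ F] [TopologicalSpace F]

/-- `v` is the derivative of `f` at `x` in the direction `h`. -/
def HasDirDeriv (f : E → F) (x h : E) (v : F) : Prop :=
  Tendsto (fun t : ℝ => t⁻¹ • (f (x + t • h) - f x)) (𝓝[≠] 0) (𝓝 v)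

theorem HasDirDeriv.unique [T2Space F] {f : E → F} {x h : E} {v v' : F}
    (hv : HasDirDeriv f x h v) (hv' : HasDirDeriv f x h v') : v = v' :=
  tendsto_nhds_unique hv hv'

theorem tendsto_add_smul [ContinuousAdd E] [ContinuousSMul ℝ E] (x h : E) :
    Tendsto (fun t : ℝ => x + t • h) (𝓝[≠] 0) (𝓝 x) := by
  have : Continuous (fun t : ℝ => x + t • h) := by fun_prop
  simpa using (this.tendsto 0).mono_left nhdsWithin_le_nhds

theorem HasDirDeriv.congr [ContinuousAdd E] [ContinuousSMul ℝ E] {f g : E → F} {U : Set E}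
    (hU : IsOpen U) (hfg : EqOn f g U) {x h : E} (hx : x ∈ U) {v : F}
    (hv : HasDirDeriv f x h v) : HasDirDeriv g x h v := by
  refine Tendsto.congr' ?_ hv
  filter_upwards [tendsto_add_smul x h (hU.mem_nhds hx)] with t ht
  rw [hfg ht, hfg hx]

theorem tendsto_mul_punctured {c : ℝ} (hc : c ≠ 0) :
    Tendsto (fun r : ℝ => r * c) (𝓝[≠] 0) (𝓝[≠] 0) := by
  refine tendsto_nhdsWithin_iff.2 ⟨?_, ?_⟩
  · have : Continuous (fun r : ℝ => r * c) := by fun_prop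
    simpa using (this.tendsto 0).mono_left nhdsWithin_le_nhds
  · filter_upwards [self_mem_nhdsWithin] with r hr
    exact mul_ne_zero hr hc

/-- Mean value theorem: a difference quotient lies in every closed convex set that contains the
directional derivatives along the segment. -/
theorem diffQuot_mem [IsTopologicalAddGroup F] [ContinuousSMul ℝ F] [LocallyConvexSpace ℝ F]
    {f : E → F} {C : Set F} (hC : Convex ℝ C) (hC' : IsClosed C) {x h : E} {t : ℝ} (ht : t ≠ 0)
    (hd : ∀ s ∈ Icc (0 : ℝ) 1, ∃ v ∈ C, HasDirDeriv f (x + (s * t) • h) h v) :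
    t⁻¹ • (f (x + t • h) - f x) ∈ C := by
  by_contra hn
  -- A functional `l` strictly separating the quotient from `C` reduces the claim to the
  -- one-variable mean value theorem for `l ∘ f` along the segment.
  obtain ⟨l, u, hl, hu⟩ := geometric_hahn_banach_closed_point hC hC' hn
  choose! v hvC hv using hd
  let γ : ℝ → ℝ := fun s => l (t⁻¹ • f (x + (s * t) • h))
  have hγ : ∀ s ∈ Icc (0 : ℝ) 1, HasDerivAt γ (l (v s)) s := by
    intro s hs
    rw [hasDerivAt_iff_tendsto_slope_zero]
    have h1 := ((l.continuous.tendsto _).comp (hv s hs)).comp (tendsto_mul_punctured ht)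
    refine h1.congr ?_
    intro r
    simp only [Function.comp, γ, ← map_sub, ← map_smul]
    congr 1
    rw [← smul_sub, smul_smul, mul_inv, add_mul, add_smul, add_assoc]
  obtain ⟨c, hc, hc'⟩ := exists_hasDerivAt_eq_slope γ (fun s => l (v s)) zero_lt_one
    (fun s hs => (hγ s hs).continuousAt.continuousWithinAt)
    (fun s hs => hγ s ⟨hs.1.le, hs.2.le⟩)
  have h1 := hl _ (hvC c ⟨hc.1.le, hc.2.le⟩)
  rw [hc'] at h1
  simp only [γ, ← map_sub, ← smul_sub] at h1
  simp only [one_mul, zero_mul, zero_smul, add_zero, sub_zero, div_one] at h1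
  linarith

theorem exists_closed_convex_nhds [IsTopologicalAddGroup F] [ContinuousSMul ℝ F]
    [LocallyConvexSpace ℝ F] {y : F} {W : Set F} (hW : W ∈ 𝓝 y) :
    ∃ C ∈ 𝓝 y, Convex ℝ C ∧ IsClosed C ∧ C ⊆ W := by
  obtain ⟨C, ⟨hC, hC'⟩, hCW⟩ := (closed_nhds_basis y).mem_iff.1 hW
  obtain ⟨D, ⟨hD, hD'⟩, hDC⟩ := (LocallyConvexSpace.convex_basis (𝕜 := ℝ) y).mem_iff.1 hC
  exact ⟨closure D, mem_of_superset hD subset_closure, hD'.closure, isClosed_closure,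
    (hC'.closure_subset_iff.2 hDC).trans hCW⟩

/-- For a `C¹` map, the difference quotients depend continuously on all parameters. -/
theorem tendsto_diffQuot [IsTopologicalAddGroup E] [ContinuousSMul ℝ E]
    [IsTopologicalAddGroup F] [ContinuousSMul ℝ F] [LocallyConvexSpace ℝ F]
    {f : E → F} {df : E × E → F} {U : Set E} (hU : IsOpen U)
    (hd : ∀ x ∈ U, ∀ h, HasDirDeriv f x h (df (x, h))) (hc : ContinuousOn df (U ×ˢ univ))
    {x : E} (hx : x ∈ U) (h : E) :
    Tendsto (fun p : (E × E) × ℝ => p.2⁻¹ • (f (p.1.1 + p.2 • p.1.2) - f p.1.1))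
      (𝓝 (x, h) ×ˢ 𝓝[≠] 0) (𝓝 (df (x, h))) := by
  intro W hW
  -- By continuity of `df`, for nearby base points and directions and small `t` the derivatives
  -- along the whole segment stay in `C`, so `diffQuot_mem` applies.
  obtain ⟨C, hC, hCc, hCcl, hCW⟩ := exists_closed_convex_nhds hW
  have hO : (U ×ˢ univ : Set (E × E)) ∈ 𝓝 (x, h) := (hU.prod isOpen_univ).mem_nhds ⟨hx, trivial⟩
  have h1 : (U ×ˢ univ) ∩ df ⁻¹' C ∈ 𝓝 (x, h) :=
    inter_mem hO ((hc.continuousAt hO) hC)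
  have h2 : Continuous (fun p : (E × E) × ℝ => (p.1.1 + p.2 • p.1.2, p.1.2)) := by fun_prop
  have h3 : (fun p : (E × E) × ℝ => (p.1.1 + p.2 • p.1.2, p.1.2)) ⁻¹'
      ((U ×ˢ univ) ∩ df ⁻¹' C) ∈ 𝓝 (x, h) ×ˢ 𝓝 (0 : ℝ) := by
    rw [← nhds_prod_eq]
    exact h2.tendsto ((x, h), 0) (by simpa using h1)
  obtain ⟨A, hA, B, hB, hAB⟩ := mem_prod_iff.1 h3
  obtain ⟨δ, hδ, hδB⟩ := Metric.mem_nhds_iff.1 hB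
  rw [mem_map, mem_prod_iff]
  refine ⟨A, hA, _, inter_mem (mem_nhdsWithin_of_mem_nhds (Metric.ball_mem_nhds _ hδ))
    self_mem_nhdsWithin, ?_⟩
  rintro ⟨⟨x', h'⟩, t⟩ ⟨hxA, ht, ht0⟩
  refine hCW (diffQuot_mem hCc hCcl ht0 fun s hs => ?_)
  have hst : s * t ∈ Metric.ball (0 : ℝ) δ := by
    rw [mem_ball_zero_iff] at ht ⊢
    rw [norm_mul, Real.norm_of_nonneg hs.1]
    exact (mul_le_of_le_one_left (norm_nonneg _) hs.2).trans_lt ht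
  have := hAB (mk_mem_prod hxA (hδB hst))
  exact ⟨_, this.2, hd _ this.1.1 _⟩

theorem HasDirDeriv.smul [ContinuousConstSMul ℝ F] {f : E → F} {x h : E} {v : F}
    (hv : HasDirDeriv f x h v) (c : ℝ) : HasDirDeriv f x (c • h) (c • v) := by
  rcases eq_or_ne c 0 with rfl | hc
  · simpa [HasDirDeriv] using tendsto_const_nhds
  · refine ((hv.comp (tendsto_mul_punctured hc)).const_smul c).congr fun t => ?_
    simp only [Function.comp, smul_smul, mul_inv]
    congr 1
    field_simp

/-- The increment along `t • (h + k)` is split at `x + t • h`. The second quotient then has a moving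
base point, which is why joint continuity from `tendsto_diffQuot` is needed. -/
theorem hasDirDeriv_add [IsTopologicalAddGroup E] [ContinuousSMul ℝ E]
    [IsTopologicalAddGroup F] [ContinuousSMul ℝ F] [LocallyConvexSpace ℝ F]
    {f : E → F} {df : E × E → F} {U : Set E} (hU : IsOpen U)
    (hd : ∀ x ∈ U, ∀ h, HasDirDeriv f x h (df (x, h))) (hc : ContinuousOn df (U ×ˢ univ))
    {x : E} (hx : x ∈ U) (h k : E) :
    HasDirDeriv f x (h + k) (df (x, h) + df (x, k)) := by
  have h1 : Tendsto (fun t : ℝ => ((x + t • h, k), t)) (𝓝[≠] 0) (𝓝 (x, k) ×ˢ 𝓝[≠] 0) :=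
    ((tendsto_add_smul x h).prodMk_nhds tendsto_const_nhds).prodMk tendsto_id
  have h2 := (hd x hx h).add ((tendsto_diffQuot hU hd hc hx k).comp h1)
  refine h2.congr fun t => ?_
  simp only [Function.comp]
  rw [← smul_add, smul_add t, ← add_assoc]
  congr 1
  abel

end DirectionalDerivatives

/-! ### Calculus rules for maps of class `C^k`. -/

section Bastiani

variable {E F H : Type w}
  [AddCommGroup E] [Module ℝ E] [TopologicalSpace E] [IsTopologicalAddGroup E] [ContinuousSMul ℝ E]
  [AddCommGroup F] [Module ℝ F] [TopologicalSpace F] [IsTopologicalAddGroup F] [ContinuousSMul ℝ F]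
  [AddCommGroup H] [Module ℝ H] [TopologicalSpace H] [IsTopologicalAddGroup H] [ContinuousSMul ℝ H]

theorem BastianiC.continuousOn {k : ℕ} {f : E → F} {U : Set E} (hf : BastianiC k f U) :
    ContinuousOn f U := by
  cases k with
  | zero => exact hf
  | succ k => exact hf.1

theorem BastianiC.mono {k : ℕ} {f : E → F} {U V : Set E} (hf : BastianiC k f U) (hV : V ⊆ U) :
    BastianiC k f V := by
  induction k generalizing E F with
  | zero => exact ContinuousOn.mono hf hV
  | succ k ih =>
    obtain ⟨hc, df, hd, hdf⟩ := hf
    exact ⟨hc.mono hV, df, fun x hx => hd x (hV hx), ih hdf (prod_mono hV Subset.rfl)⟩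

theorem BastianiC.congr {k : ℕ} {f g : E → F} {U : Set E} (hf : BastianiC k f U) (hU : IsOpen U)
    (hfg : EqOn f g U) : BastianiC k g U := by
  cases k with
  | zero => exact ContinuousOn.congr hf hfg.symm
  | succ k =>
    obtain ⟨hc, df, hd, hdf⟩ := hf
    exact ⟨hc.congr hfg.symm, df, fun x hx h => HasDirDeriv.congr hU hfg hx (hd x hx h), hdf⟩

theorem BastianiC.of_succ {k : ℕ} {f : E → F} {U : Set E} (hf : BastianiC (k + 1) f U) :
    BastianiC k f U := by
  induction k generalizing E F with
  | zero => exact hf.1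
  | succ k ih =>
    obtain ⟨hc, df, hd, hdf⟩ := hf
    exact ⟨hc, df, hd, ih hdf⟩

/-- Limits in a Hausdorff space are unique, so the local derivatives agree on overlaps and glue to
one `df`, to which the induction applies. -/
theorem BastianiC.of_local [T2Space F] {k : ℕ} {f : E → F} {U : Set E} (hU : IsOpen U)
    (hf : ∀ x ∈ U, ∃ V, IsOpen V ∧ x ∈ V ∧ BastianiC k f (U ∩ V)) : BastianiC k f U := by
  have hcont : ContinuousOn f U := by
    intro x hx
    obtain ⟨V, hV, hxV, h⟩ := hf x hx
    exact (h.continuousOn.continuousAt ((hU.inter hV).mem_nhds ⟨hx, hxV⟩)).continuousWithinAt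
  induction k generalizing E F with
  | zero => exact hcont
  | succ k ih =>
    have hex : ∀ p : E × E, p.1 ∈ U → ∃ v, HasDirDeriv f p.1 p.2 v := by
      rintro ⟨x, h⟩ hx
      obtain ⟨V, hV, hxV, -, df, hd, -⟩ := hf x hx
      exact ⟨_, hd x ⟨hx, hxV⟩ h⟩
    choose! df hdf using hex
    have hloc : ∀ p ∈ U ×ˢ (univ : Set E), ∃ V, IsOpen V ∧ p ∈ V ∧
        BastianiC k df ((U ×ˢ univ) ∩ V) := by
      rintro ⟨x, h⟩ ⟨hx, -⟩
      obtain ⟨V, hV, hxV, -, df', hd', hk⟩ := hf x hx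
      refine ⟨V ×ˢ univ, hV.prod isOpen_univ, ⟨hxV, trivial⟩, ?_⟩
      rw [prod_inter_prod, inter_univ]
      refine hk.congr ((hU.inter hV).prod isOpen_univ) ?_
      rintro ⟨y, l⟩ ⟨hy, -⟩
      exact HasDirDeriv.unique (hd' y hy l) (hdf (y, l) hy.1)
    refine ⟨hcont, df, fun x hx h => hdf (x, h) hx, ih (hU.prod isOpen_univ) hloc ?_⟩
    intro p hp
    obtain ⟨V, hV, hxV, h⟩ := hloc p hp
    exact (h.continuousOn.continuousAt
      (((hU.prod isOpen_univ).inter hV).mem_nhds ⟨hp, hxV⟩)).continuousWithinAt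

theorem bastianiC_clm (L : E →L[ℝ] F) (k : ℕ) (U : Set E) : BastianiC k L U := by
  induction k generalizing E F with
  | zero => exact L.continuous.continuousOn
  | succ k ih =>
    refine ⟨L.continuous.continuousOn, L ∘ Prod.snd, fun x _ h => ?_,
      ih (L.comp (ContinuousLinearMap.snd ℝ E E)) _⟩
    refine tendsto_const_nhds.congr' ?_
    filter_upwards [self_mem_nhdsWithin] with t ht
    have ht' : t ≠ 0 := ht
    simp [smul_smul, ht']

theorem bastianiC_const (c : F) (k : ℕ) (U : Set E) : BastianiC k (fun _ => c) U := by
  induction k generalizing E F with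
  | zero => exact continuousOn_const
  | succ k ih =>
    refine ⟨continuousOn_const, fun _ => 0, fun x _ h => ?_, ih 0 _⟩
    simpa using tendsto_const_nhds

theorem BastianiC.prodMk {k : ℕ} {f : E → F} {g : E → H} {U : Set E} (hf : BastianiC k f U)
    (hg : BastianiC k g U) : BastianiC k (fun x => (f x, g x)) U := by
  induction k generalizing E F H with
  | zero => exact ContinuousOn.prodMk hf hg
  | succ k ih =>
    obtain ⟨hc, df, hd, hdf⟩ := hf
    obtain ⟨hc', dg, hd', hdg⟩ := hg
    exact ⟨hc.prodMk hc', _, fun x hx h => (hd x hx h).prodMk_nhds (hd' x hx h), ih hdf hdg⟩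

theorem BastianiC.comp_clm {k : ℕ} {f : F → H} {U : Set F} (hf : BastianiC k f U)
    (L : E →L[ℝ] F) : BastianiC k (f ∘ L) (L ⁻¹' U) := by
  induction k generalizing E F H with
  | zero => exact ContinuousOn.comp hf L.continuous.continuousOn fun _ hx => hx
  | succ k ih =>
    obtain ⟨hc, df, hd, hdf⟩ := hf
    refine ⟨hc.comp L.continuous.continuousOn fun _ hx => hx, df ∘ (L.prodMap L),
      fun x hx h => ?_, ?_⟩
    · simpa using hd (L x) hx (L h)
    · exact (ih hdf (L.prodMap L)).mono fun p hp => ⟨hp.1, trivial⟩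

/-- The chain rule for directional derivatives. -/
theorem hasDirDeriv_comp [LocallyConvexSpace ℝ H] {f : E → F} {g : F → H} {dg : F × F → H}
    {V : Set F} (hV : IsOpen V) (hd : ∀ y ∈ V, ∀ l, HasDirDeriv g y l (dg (y, l)))
    (hc : ContinuousOn dg (V ×ˢ univ)) {x h : E} (hx : f x ∈ V) {v : F}
    (hf : HasDirDeriv f x h v) : HasDirDeriv (g ∘ f) x h (dg (f x, v)) := by
  have h1 : Tendsto (fun t : ℝ => ((f x, t⁻¹ • (f (x + t • h) - f x)), t)) (𝓝[≠] 0)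
      (𝓝 (f x, v) ×ˢ 𝓝[≠] 0) :=
    (tendsto_const_nhds.prodMk_nhds hf).prodMk tendsto_id
  refine ((tendsto_diffQuot hV hd hc hx v).comp h1).congr' ?_
  filter_upwards [self_mem_nhdsWithin] with t ht
  have ht' : t ≠ 0 := ht
  simp [smul_smul, ht']

/-- The derivative of `g ∘ f` is `dg ∘ (f ∘ fst, df)`, again a composition, now of maps of class one
lower; hence the induction over varying spaces. -/
theorem BastianiC.comp [LocallyConvexSpace ℝ H] {k : ℕ} {f : E → F} {g : F → H} {U : Set E}
    {V : Set F} (hg : BastianiC k g V) (hf : BastianiC k f U) (hV : IsOpen V) (h : MapsTo f U V) :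
    BastianiC k (g ∘ f) U := by
  induction k generalizing E F H with
  | zero => exact ContinuousOn.comp hg hf h
  | succ k ih =>
    have hf' := hf.of_succ
    obtain ⟨hfc, df, hdf, hdfk⟩ := hf
    obtain ⟨hgc, dg, hdg, hdgk⟩ := hg
    refine ⟨hgc.comp hfc h, dg ∘ fun p => (f p.1, df p),
      fun x hx l => hasDirDeriv_comp hV hdg hdgk.continuousOn (h hx) (hdf x hx l), ?_⟩
    have h1 : BastianiC k (f ∘ Prod.fst) (U ×ˢ (univ : Set E)) :=
      (hf'.comp_clm (ContinuousLinearMap.fst ℝ E E)).mono fun p hp => hp.1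
    exact ih hdgk (h1.prodMk hdfk) (hV.prod isOpen_univ) fun p hp => ⟨h hp.1, trivial⟩

open Classical in
/-- Smoothness is not affected by restricting the range to a closed linear subspace. -/
theorem BastianiC.of_val {k : ℕ} {K : Submodule ℝ F} (hK : IsClosed (K : Set F)) {f : E → K}
    {U : Set E} (hf : BastianiC k (fun x => (f x : F)) U) (hU : IsOpen U) : BastianiC k f U := by
  induction k generalizing E with
  | zero => exact IsInducing.subtypeVal.continuousOn_iff.2 hf
  | succ k ih =>
    obtain ⟨hc, df, hd, hdf⟩ := hf
    -- The difference quotients lie in the subspace `K`, and `K` is closed, so the derivative takes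
    -- its values in `K` as well.
    have hmem : ∀ p ∈ U ×ˢ (univ : Set E), df p ∈ K := by
      rintro ⟨x, h⟩ ⟨hx, -⟩
      exact hK.mem_of_tendsto (hd x hx h)
        (Eventually.of_forall fun t => K.smul_mem _ (K.sub_mem (f _).2 (f _).2))
    let df' : E × E → K := fun p => if hp : df p ∈ K then ⟨df p, hp⟩ else 0
    have hdf' : ∀ p ∈ U ×ˢ (univ : Set E), (df' p : F) = df p := fun p hp => by
      simp [df', hmem p hp]
    refine ⟨IsInducing.subtypeVal.continuousOn_iff.2 hc, df', fun x hx h => ?_, ih ?_ ?_⟩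
    · refine IsInducing.subtypeVal.tendsto_nhds_iff.2 ?_
      rw [hdf' _ ⟨hx, trivial⟩]
      exact hd x hx h
    · exact hdf.congr (hU.prod isOpen_univ) fun p hp => (hdf' p hp).symm
    · exact hU.prod isOpen_univ

theorem BastianiSmooth.continuousOn {f : E → F} {U : Set E} (hf : BastianiSmooth f U) :
    ContinuousOn f U := hf 0

theorem BastianiSmooth.mono {f : E → F} {U V : Set E} (hf : BastianiSmooth f U) (hV : V ⊆ U) :
    BastianiSmooth f V := fun k => (hf k).mono hV

theorem BastianiSmooth.congr {f g : E → F} {U : Set E} (hf : BastianiSmooth f U) (hU : IsOpen U)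
    (hfg : EqOn f g U) : BastianiSmooth g U := fun k => (hf k).congr hU hfg

theorem BastianiSmooth.of_local [T2Space F] {f : E → F} {U : Set E} (hU : IsOpen U)
    (hf : ∀ x ∈ U, ∃ V, IsOpen V ∧ x ∈ V ∧ BastianiSmooth f (U ∩ V)) : BastianiSmooth f U :=
  fun k => BastianiC.of_local hU fun x hx =>
    let ⟨V, hV, hxV, h⟩ := hf x hx
    ⟨V, hV, hxV, h k⟩

theorem bastianiSmooth_clm (L : E →L[ℝ] F) (U : Set E) : BastianiSmooth L U :=
  fun k => bastianiC_clm L k U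

theorem bastianiSmooth_const (c : F) (U : Set E) : BastianiSmooth (fun _ => c) U :=
  fun k => bastianiC_const c k U

theorem BastianiSmooth.prodMk {f : E → F} {g : E → H} {U : Set E} (hf : BastianiSmooth f U)
    (hg : BastianiSmooth g U) : BastianiSmooth (fun x => (f x, g x)) U :=
  fun k => (hf k).prodMk (hg k)

theorem BastianiSmooth.comp [LocallyConvexSpace ℝ H] {f : E → F} {g : F → H} {U : Set E}
    {V : Set F} (hg : BastianiSmooth g V) (hf : BastianiSmooth f U) (hV : IsOpen V)
    (h : MapsTo f U V) : BastianiSmooth (g ∘ f) U :=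
  fun k => (hg k).comp (hf k) hV h

theorem BastianiSmooth.of_val {K : Submodule ℝ F} (hK : IsClosed (K : Set F)) {f : E → K}
    {U : Set E} (hf : BastianiSmooth (fun x => (f x : F)) U) (hU : IsOpen U) :
    BastianiSmooth f U :=
  fun k => (hf k).of_val hK hU

end Bastiani

/-! ## Plots -/

namespace LCAtlas

section Plots

variable {E F : Type w}
  [AddCommGroup E] [Module ℝ E] [TopologicalSpace E] [IsTopologicalAddGroup E] [ContinuousSMul ℝ E]
  [LocallyConvexSpace ℝ E] [T2Space E]
  [AddCommGroup F] [Module ℝ F] [TopologicalSpace F] [IsTopologicalAddGroup F] [ContinuousSMul ℝ F]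
  [LocallyConvexSpace ℝ F] [T2Space F]
  {M : Type u₁} {N : Type u₂} [TopologicalSpace M] [TopologicalSpace N]
  {𝓐 : LCAtlas.{u₁, w} M} {𝓑 : LCAtlas.{u₂, w} N}

/-- A plot of `(M, 𝓐)`: a smooth map into `M` from an open subset of a locally convex space. -/
structure IsPlot (𝓐 : LCAtlas.{u₁, w} M) (f : E → M) (O : Set E) : Prop where
  isOpen : IsOpen O
  continuousOn : ContinuousOn f O
  smooth : ∀ ψ ∈ 𝓐, BastianiSmooth (ψ.hom ∘ f) (O ∩ f ⁻¹' ψ.hom.source)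

theorem IsPlot.isOpen_inter {f : E → M} {O : Set E} (hf : 𝓐.IsPlot f O) {V : Set M}
    (hV : IsOpen V) : IsOpen (O ∩ f ⁻¹' V) :=
  hf.continuousOn.isOpen_inter_preimage hf.isOpen hV

theorem IsPlot.mono {f : E → M} {O O' : Set E} (hf : 𝓐.IsPlot f O) (hO' : IsOpen O')
    (h : O' ⊆ O) : 𝓐.IsPlot f O' where
  isOpen := hO'
  continuousOn := hf.continuousOn.mono h
  smooth ψ hψ := (hf.smooth ψ hψ).mono (inter_subset_inter_left _ h)

theorem IsPlot.congr {f g : E → M} {O : Set E} (hf : 𝓐.IsPlot f O) (h : EqOn f g O) :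
    𝓐.IsPlot g O where
  isOpen := hf.isOpen
  continuousOn := hf.continuousOn.congr h.symm
  smooth ψ hψ := by
    have : O ∩ g ⁻¹' ψ.hom.source = O ∩ f ⁻¹' ψ.hom.source := by
      ext x
      simp only [mem_inter_iff, mem_preimage, and_congr_right_iff]
      intro hx
      rw [h hx]
    rw [this]
    exact (hf.smooth ψ hψ).congr (hf.isOpen_inter ψ.hom.open_source)
      fun x hx => congrArg ψ.hom (h hx.1)

theorem IsPlot.of_local {f : E → M} {O : Set E} (hO : IsOpen O)
    (hf : ∀ x ∈ O, ∃ V, IsOpen V ∧ x ∈ V ∧ 𝓐.IsPlot f (O ∩ V)) : 𝓐.IsPlot f O := by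
  have hc : ContinuousOn f O := by
    intro x hx
    obtain ⟨V, hV, hxV, h⟩ := hf x hx
    exact (h.continuousOn.continuousAt ((hO.inter hV).mem_nhds ⟨hx, hxV⟩)).continuousWithinAt
  refine ⟨hO, hc, fun ψ hψ => ?_⟩
  refine BastianiSmooth.of_local (hc.isOpen_inter_preimage hO ψ.hom.open_source) ?_
  intro x hx
  obtain ⟨V, hV, hxV, h⟩ := hf x hx.1
  refine ⟨V, hV, hxV, (h.smooth ψ hψ).mono ?_⟩
  rintro y ⟨⟨h1, h2⟩, h3⟩
  exact ⟨⟨h1, h3⟩, h2⟩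

theorem IsPlot.comp {f : E → M} {O : Set E} (hf : 𝓐.IsPlot f O) {g : F → E} {O' : Set F}
    (hO' : IsOpen O') (hg : BastianiSmooth g O') (h : MapsTo g O' O) : 𝓐.IsPlot (f ∘ g) O' where
  isOpen := hO'
  continuousOn := hf.continuousOn.comp hg.continuousOn h
  smooth ψ hψ := (hf.smooth ψ hψ).comp (hg.mono inter_subset_left)
    (hf.isOpen_inter ψ.hom.open_source) fun _ hx => ⟨h hx.1, hx.2⟩

/-- A function that is smooth in all charts is smooth along all plots. -/
theorem IsPlot.smooth_comp (h𝓐 : ∀ x : M, ∃ φ ∈ 𝓐, x ∈ φ.hom.source) {p : E → M} {O : Set E}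
    (hp : 𝓐.IsPlot p O) {g : M → F} {D : Set M} (hD : IsOpen D)
    (hg : ∀ ψ ∈ 𝓐, BastianiSmooth (g ∘ ψ.hom.symm) (ψ.hom.target ∩ ψ.hom.symm ⁻¹' D)) :
    BastianiSmooth (g ∘ p) (O ∩ p ⁻¹' D) := by
  refine BastianiSmooth.of_local (hp.isOpen_inter hD) fun x hx => ?_
  obtain ⟨ψ, hψ, hxψ⟩ := h𝓐 (p x)
  have hopen := hp.isOpen_inter (ψ.hom.open_source.inter hD)
  refine ⟨_, hopen, ⟨hx.1, hxψ, hx.2⟩, ?_⟩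
  have h1 : BastianiSmooth ((g ∘ ψ.hom.symm) ∘ (ψ.hom ∘ p)) (O ∩ p ⁻¹' (ψ.hom.source ∩ D)) := by
    refine (hg ψ hψ).comp ((hp.smooth ψ hψ).mono fun y hy => ⟨hy.1, hy.2.1⟩)
      (ψ.hom.symm.isOpen_inter_preimage hD) ?_
    intro y hy
    refine ⟨ψ.hom.map_source hy.2.1, ?_⟩
    simpa [ψ.hom.left_inv hy.2.1] using hy.2.2
  refine (h1.congr hopen fun y hy => ?_).mono inter_subset_right
  simp [ψ.hom.left_inv hy.2.1]

theorem SmoothOn.comp_plot {f : M → N} {W : Set M} (hf : 𝓐.SmoothOn 𝓑 f W) (hW : IsOpen W)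
    (h𝓐 : ∀ x : M, ∃ φ ∈ 𝓐, x ∈ φ.hom.source) {p : E → M} {O : Set E}
    (hp : 𝓐.IsPlot p O) (h : MapsTo p O W) : 𝓑.IsPlot (f ∘ p) O where
  isOpen := hp.isOpen
  continuousOn := hf.1.comp hp.continuousOn h
  smooth ψ hψ := by
    have h1 := hp.smooth_comp h𝓐 (g := ψ.hom ∘ f)
      (hf.1.isOpen_inter_preimage hW ψ.hom.open_source) (fun φ hφ => hf.2 φ hφ ψ hψ)
    exact h1.mono fun x hx => ⟨hx.1, h hx.1, hx.2⟩

theorem smoothOn_of_plot {f : M → N} {W : Set M} (hf : ContinuousOn f W)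
    (h : ∀ φ ∈ 𝓐, 𝓑.IsPlot (f ∘ φ.hom.symm) (φ.hom.target ∩ φ.hom.symm ⁻¹' W)) :
    𝓐.SmoothOn 𝓑 f W := by
  refine ⟨hf, fun φ hφ ψ hψ => ((h φ hφ).smooth ψ hψ).mono ?_⟩
  rintro x ⟨h1, h2, h3⟩
  exact ⟨⟨h1, h2⟩, h3⟩

theorem Admits.isPlot_symm {φ : LCChart.{u₁, w} M} (hφ : 𝓐.Admits φ) :
    𝓐.IsPlot φ.hom.symm φ.hom.target where
  isOpen := φ.hom.open_target
  continuousOn := φ.hom.symm.continuousOn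
  smooth ψ hψ := (hφ ψ hψ).1

theorem Admits.smooth_comp {φ : LCChart.{u₁, w} M} (hφ : 𝓐.Admits φ)
    (h𝓐 : ∀ x : M, ∃ φ ∈ 𝓐, x ∈ φ.hom.source) {p : E → M} {O : Set E} (hp : 𝓐.IsPlot p O) :
    BastianiSmooth (φ.hom ∘ p) (O ∩ p ⁻¹' φ.hom.source) :=
  hp.smooth_comp h𝓐 φ.hom.open_source fun ψ hψ => (hφ ψ hψ).2

theorem IsManifold.admits (h𝓐 : 𝓐.IsManifold) {φ : LCChart.{u₁, w} M} (hφ : φ ∈ 𝓐) :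
    𝓐.Admits φ := fun ψ hψ => ⟨h𝓐.compatible φ hφ ψ hψ, h𝓐.compatible ψ hψ φ hφ⟩

theorem isPlot_const (m : M) {O : Set E} (hO : IsOpen O) : 𝓐.IsPlot (fun _ : E => m) O :=
  ⟨hO, continuousOn_const, fun ψ _ => bastianiSmooth_const (ψ.hom m) _⟩

/-! ### Products -/

theorem IsPlot.prodMk {f : E → M} {g : E → N} {O : Set E} (hf : 𝓐.IsPlot f O)
    (hg : 𝓑.IsPlot g O) : (𝓐.prod 𝓑).IsPlot (fun x => (f x, g x)) O where
  isOpen := hf.isOpen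
  continuousOn := hf.continuousOn.prodMk hg.continuousOn
  smooth := by
    rintro _ ⟨φ, hφ, ψ, hψ, rfl⟩
    exact ((hf.smooth φ hφ).mono fun x hx => ⟨hx.1, hx.2.1⟩).prodMk
      ((hg.smooth ψ hψ).mono fun x hx => ⟨hx.1, hx.2.2⟩)

theorem IsPlot.fst (h𝓑 : ∀ x : N, ∃ φ ∈ 𝓑, x ∈ φ.hom.source) {f : E → M × N} {O : Set E}
    (hf : (𝓐.prod 𝓑).IsPlot f O) : 𝓐.IsPlot (fun x => (f x).1) O where
  isOpen := hf.isOpen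
  continuousOn := continuous_fst.comp_continuousOn hf.continuousOn
  smooth φ hφ := by
    refine BastianiSmooth.of_local
      (hf.isOpen_inter (φ.hom.open_source.preimage continuous_fst)) fun x hx => ?_
    obtain ⟨ψ, hψ, hxψ⟩ := h𝓑 (f x).2
    have h1 := hf.smooth _ ⟨φ, hφ, ψ, hψ, rfl⟩
    have h2 := hf.isOpen_inter (φ.prod ψ).hom.open_source
    refine ⟨_, h2, ⟨hx.1, hx.2, hxψ⟩, ?_⟩
    exact ((bastianiSmooth_clm (ContinuousLinearMap.fst ℝ φ.Model ψ.Model) univ).comp h1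
      isOpen_univ (mapsTo_univ _ _)).mono inter_subset_right

theorem IsPlot.snd (h𝓐 : ∀ x : M, ∃ φ ∈ 𝓐, x ∈ φ.hom.source) {f : E → M × N} {O : Set E}
    (hf : (𝓐.prod 𝓑).IsPlot f O) : 𝓑.IsPlot (fun x => (f x).2) O where
  isOpen := hf.isOpen
  continuousOn := continuous_snd.comp_continuousOn hf.continuousOn
  smooth ψ hψ := by
    refine BastianiSmooth.of_local
      (hf.isOpen_inter (ψ.hom.open_source.preimage continuous_snd)) fun x hx => ?_
    obtain ⟨φ, hφ, hxφ⟩ := h𝓐 (f x).1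
    have h1 := hf.smooth _ ⟨φ, hφ, ψ, hψ, rfl⟩
    have h2 := hf.isOpen_inter (φ.prod ψ).hom.open_source
    refine ⟨_, h2, ⟨hx.1, hxφ, hx.2⟩, ?_⟩
    exact ((bastianiSmooth_clm (ContinuousLinearMap.snd ℝ φ.Model ψ.Model) univ).comp h1
      isOpen_univ (mapsTo_univ _ _)).mono inter_subset_right

theorem prod_cover (h𝓐 : ∀ x : M, ∃ φ ∈ 𝓐, x ∈ φ.hom.source)
    (h𝓑 : ∀ x : N, ∃ φ ∈ 𝓑, x ∈ φ.hom.source) (x : M × N) :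
    ∃ φ ∈ 𝓐.prod 𝓑, x ∈ φ.hom.source := by
  obtain ⟨φ, hφ, h1⟩ := h𝓐 x.1
  obtain ⟨ψ, hψ, h2⟩ := h𝓑 x.2
  exact ⟨_, ⟨φ, hφ, ψ, hψ, rfl⟩, h1, h2⟩

/-! ### Submanifolds -/

theorem _root_.LCChart.restrict_hom_apply (φ : LCChart.{u₁, w} M) {A : Set M} (n : A)
    (K : Submodule ℝ φ.Model) (h : φ.hom.IsImage A (K : Set φ.Model)) {x : A}
    (hx : (x : M) ∈ φ.hom.source) :
    Subtype.val (p := (· ∈ K)) ((φ.restrict n K h).hom x) = φ.hom x := by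
  have hF : φ.hom x ∈ K := (h hx).2 x.2
  exact congrArg (Subtype.val (p := (· ∈ K))) (dif_pos hF)

theorem _root_.LCChart.restrict_symm_apply (φ : LCChart.{u₁, w} M) {A : Set M} (n : A)
    (K : Submodule ℝ φ.Model) (h : φ.hom.IsImage A (K : Set φ.Model)) {y : K}
    (hy : (y : φ.Model) ∈ φ.hom.target) :
    (((φ.restrict n K h).hom.symm y : A) : M) = φ.hom.symm y := by
  have hN : φ.hom.symm y ∈ A := (h.symm hy).2 y.2
  exact congrArg (Subtype.val (p := (· ∈ A))) (dif_pos hN)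

theorem sub_cover {A : Set M} (hA : 𝓐.IsSubmanifold A) (x : A) :
    ∃ φ ∈ 𝓐.sub A, x ∈ φ.hom.source := by
  obtain ⟨φ, hφ, hx, K, hK, h⟩ := hA x x.2
  exact ⟨φ.restrict x K h, ⟨φ, x, K, h, hφ, hK, rfl⟩, hx⟩

/-- Together with `IsPlot.val` this identifies plots of a submanifold with ambient plots that take
values in it, so nested submanifolds need no adapted charts. Closedness of the model subspace enters
through `BastianiSmooth.of_val`. -/
theorem IsPlot.of_val (h𝓐 : ∀ x : M, ∃ φ ∈ 𝓐, x ∈ φ.hom.source) {A : Set M} {f : E → A}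
    {O : Set E} (hf : 𝓐.IsPlot (fun x => (f x : M)) O) : (𝓐.sub A).IsPlot f O where
  isOpen := hf.isOpen
  continuousOn := IsInducing.subtypeVal.continuousOn_iff.2 hf.continuousOn
  smooth := by
    rintro _ ⟨φ, n, K, h, hφ, hK, rfl⟩
    have hopen := hf.isOpen_inter φ.hom.open_source
    refine BastianiSmooth.of_val (K := K) hK ?_ hopen
    refine (hφ.smooth_comp h𝓐 hf).congr hopen fun x hx => ?_
    exact (φ.restrict_hom_apply n K h hx.2).symm

theorem isPlot_restrict_symm {φ : LCChart.{u₁, w} M} (hφ : 𝓐.Admits φ) {A : Set M} (n : A)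
    (K : Submodule ℝ φ.Model) (h : φ.hom.IsImage A (K : Set φ.Model)) :
    𝓐.IsPlot (fun y => ((φ.restrict n K h).hom.symm y : M)) (φ.restrict n K h).hom.target := by
  have h1 : 𝓐.IsPlot (φ.hom.symm ∘ K.subtypeL) (φ.restrict n K h).hom.target :=
    hφ.isPlot_symm.comp (φ.restrict n K h).hom.open_target (bastianiSmooth_clm K.subtypeL _)
      fun y hy => hy
  exact h1.congr fun y hy => (φ.restrict_symm_apply n K h hy).symm

theorem IsPlot.val {A : Set M} (hA : 𝓐.IsSubmanifold A) {f : E → A} {O : Set E}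
    (hf : (𝓐.sub A).IsPlot f O) : 𝓐.IsPlot (fun x => (f x : M)) O := by
  refine IsPlot.of_local hf.isOpen fun x hx => ?_
  obtain ⟨φ, hφ, hxφ, K, hK, h⟩ := hA (f x) (f x).2
  have hmem : φ.restrict (f x) K h ∈ 𝓐.sub A := ⟨φ, f x, K, h, hφ, hK, rfl⟩
  have hopen := hf.isOpen_inter (φ.restrict (f x) K h).hom.open_source
  refine ⟨_, hopen, ⟨hx, hxφ⟩, ?_⟩
  rw [inter_eq_self_of_subset_right inter_subset_left]
  have h1 := (isPlot_restrict_symm hφ (f x) K h).comp hopen (hf.smooth _ hmem)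
    fun y hy => (φ.restrict (f x) K h).hom.map_source hy.2
  exact h1.congr fun y hy => congrArg Subtype.val ((φ.restrict (f x) K h).hom.left_inv hy.2)

theorem IsManifold.sub (h𝓐 : 𝓐.IsManifold) {A : Set M} (hA : 𝓐.IsSubmanifold A) :
    (𝓐.sub A).IsManifold where
  t2 := have := h𝓐.t2; inferInstance
  cover := sub_cover hA
  compatible := by
    rintro _ ⟨φ, n, K, h, hφ, hK, rfl⟩ ψ hψ
    exact (IsPlot.of_val h𝓐.cover (isPlot_restrict_symm hφ n K h)).smooth ψ hψ

end Plots

end LCAtlas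

/-! ## The inverse function theorem in finite dimension -/

section FiniteDimensional

/-- The unit sphere is compact, so continuity of `df` makes `df (z, h)` close to `df (x, h)`
uniformly in unit vectors `h` for `z` near `x`. The mean value theorem, with a closed ball as convex
set, turns this into strict differentiability. -/
theorem exists_hasStrictFDerivAt {V : Type u₁} {W : Type u₂} [NormedAddCommGroup V]
    [NormedSpace ℝ V] [FiniteDimensional ℝ V] [NormedAddCommGroup W] [NormedSpace ℝ W]
    {f : V → W} {df : V × V → W} {U : Set V} (hU : IsOpen U)
    (hd : ∀ x ∈ U, ∀ h, HasDirDeriv f x h (df (x, h))) (hc : ContinuousOn df (U ×ˢ univ))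
    {x : V} (hx : x ∈ U) :
    ∃ f' : V →L[ℝ] W, (∀ h, f' h = df (x, h)) ∧ HasStrictFDerivAt f f' x := by
  have hsmul : ∀ y ∈ U, ∀ (c : ℝ) h, df (y, c • h) = c • df (y, h) := fun y hy c h =>
    HasDirDeriv.unique (hd y hy (c • h)) ((hd y hy h).smul c)
  let f' : V →ₗ[ℝ] W :=
    { toFun := fun h => df (x, h)
      map_add' := fun h k =>
        HasDirDeriv.unique (hd x hx (h + k)) (hasDirDeriv_add hU hd hc hx h k)
      map_smul' := fun c h => hsmul x hx c h }
  refine ⟨LinearMap.toContinuousLinearMap f', fun h => rfl, ?_⟩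
  refine HasStrictFDerivAt.of_isLittleO (Asymptotics.isLittleO_iff.2 fun ε hε => ?_)
  have hunif : ∀ᶠ z in 𝓝 x, ∀ h ∈ Metric.sphere (0 : V) 1,
      z ∈ U ∧ df (z, h) ∈ Metric.closedBall (df (x, h)) ε := by
    refine (isCompact_sphere (0 : V) 1).eventually_forall_of_forall_eventually fun h _ => ?_
    have hO : (U ×ˢ univ : Set (V × V)) ∈ 𝓝 (x, h) :=
      (hU.prod isOpen_univ).mem_nhds ⟨hx, trivial⟩
    have h1 : ContinuousAt df (x, h) := hc.continuousAt hO
    have h2 : ContinuousAt (fun p : V × V => df (x, p.2)) (x, h) := by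
      have : ContinuousAt df ((fun p : V × V => (x, p.2)) (x, h)) := h1
      exact this.comp (f := fun p : V × V => (x, p.2)) (by fun_prop)
    have h3 : Tendsto (fun p : V × V => dist (df p) (df (x, p.2))) (𝓝 (x, h)) (𝓝 0) := by
      simpa using h1.tendsto.dist h2.tendsto
    filter_upwards [hO, h3.eventually (gt_mem_nhds hε)] with p hp hp'
    exact ⟨hp.1, hp'.le⟩
  obtain ⟨δ, hδ, hball⟩ := Metric.eventually_nhds_iff_ball.1 hunif
  filter_upwards [prod_mem_nhds (Metric.ball_mem_nhds x hδ) (Metric.ball_mem_nhds x hδ)]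
  rintro ⟨y, z⟩ ⟨hy, hz⟩
  rcases eq_or_ne y z with rfl | hyz
  · simp
  have ht : ‖y - z‖ ≠ 0 := norm_ne_zero_iff.2 (sub_ne_zero.2 hyz)
  set t := ‖y - z‖ with htdef
  set h := t⁻¹ • (y - z) with hh
  have hnorm : h ∈ Metric.sphere (0 : V) 1 := by
    rw [mem_sphere_zero_iff_norm, hh, norm_smul, norm_inv, htdef, norm_norm, inv_mul_cancel₀ ht]
  have hth : t • h = y - z := by rw [hh, smul_smul, mul_inv_cancel₀ ht, one_smul]
  have key := diffQuot_mem (f := f) (x := z) (h := h) (convex_closedBall (df (x, h)) ε)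
    Metric.isClosed_closedBall ht fun s hs => by
      have hmem : z + (s * t) • h ∈ Metric.ball x δ := by
        rw [mul_smul, hth]
        exact (convex_ball x δ).add_smul_sub_mem hz hy hs
      have := hball _ hmem h hnorm
      exact ⟨_, this.2, hd _ this.1 h⟩
  have hf' : f' (y - z) = t • df (x, h) := by rw [← hth]; exact hsmul x hx t h
  rw [hth, add_sub_cancel] at key
  rw [mem_closedBall_iff_norm] at key
  have : f y - f z - f' (y - z) = t • (t⁻¹ • (f y - f z) - df (x, h)) := by
    rw [hf', smul_sub, smul_smul, mul_inv_cancel₀ ht, one_smul]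
  change ‖f y - f z - f' (y - z)‖ ≤ ε * ‖y - z‖
  rw [this, norm_smul, htdef, norm_norm, mul_comm, ← htdef]
  gcongr

/-- In finite dimension an injective derivative is surjective, and a strictly differentiable map
with surjective derivative is locally open. As `K` carries no norm, the argument is transported to
`ℝ^n` by `e`. -/
theorem map_nhds_eq_of_dirDeriv_injective {K : Type u₁} [AddCommGroup K] [Module ℝ K]
    [TopologicalSpace K] [IsTopologicalAddGroup K] [ContinuousSMul ℝ K] [T2Space K]
    [FiniteDimensional ℝ K] {f : K → K} {df : K × K → K} {U : Set K} (hU : IsOpen U)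
    (hd : ∀ x ∈ U, ∀ h, HasDirDeriv f x h (df (x, h))) (hc : ContinuousOn df (U ×ˢ univ))
    {x : K} (hx : x ∈ U) (hinj : ∀ h, df (x, h) = 0 → h = 0) : map f (𝓝 x) = 𝓝 (f x) := by
  let e : K ≃L[ℝ] (Fin (Module.finrank ℝ K) → ℝ) := ContinuousLinearEquiv.ofFinrankEq (by simp)
  obtain ⟨f', hf', hs⟩ := exists_hasStrictFDerivAt (f := e ∘ f ∘ e.symm)
    (df := fun p => e (df (e.symm p.1, e.symm p.2))) (U := e.symm ⁻¹' U)
    (hU.preimage e.symm.continuous)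
    (fun y hy h => by
      refine ((e.continuous.tendsto _).comp (hd (e.symm y) hy (e.symm h))).congr fun t => ?_
      simp)
    (e.continuous.comp_continuousOn (hc.comp (by fun_prop) fun p hp => ⟨hp.1, trivial⟩))
    (x := e x) (by simpa using hx)
  have hinj' : Function.Injective f' := by
    rw [injective_iff_map_eq_zero]
    intro h hh
    rw [hf'] at hh
    have := hinj (e.symm h) (by simpa using hh)
    simpa using this
  have hsurj : Function.Surjective f' :=
    (LinearMap.injective_iff_surjective (f := f'.toLinearMap)).1 hinj'
  have h1 := hs.map_nhds_eq_of_surj (LinearMap.range_eq_top.2 hsurj)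
  have h2 : 𝓝 (e x) = map e (𝓝 x) := (e.toHomeomorph.map_nhds_eq x).symm
  have h3 : (e ∘ f ∘ e.symm) (e x) = e (f x) := by simp
  rw [h3, h2, map_map, show 𝓝 (e (f x)) = map e (𝓝 (f x)) from
    (e.toHomeomorph.map_nhds_eq (f x)).symm] at h1
  have h4 : (e ∘ f ∘ e.symm) ∘ e = e ∘ f := by ext1 y; simp
  rw [h4, ← map_map] at h1
  exact map_injective e.injective h1

end FiniteDimensional

/-! ## Compact Lie groups are co-Hopfian -/

section CompactGroups

/-- The identity component `C` is open, so `f C` is an open, hence clopen, subgroup and contains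
`C`; this makes the self-map of `K ⧸ C` induced by `f` injective. By compactness `K ⧸ C` is finite,
so that map is also surjective. -/
theorem surjective_of_nhds_one_le_map {K : Type u₁} [Group K] [TopologicalSpace K]
    [IsTopologicalGroup K] [CompactSpace K] {C₀ : Set K} (hC₀ : C₀ ∈ 𝓝 1)
    (hC₀' : IsPreconnected C₀) (f : K →* K) (hf : Continuous f) (hinj : Function.Injective f)
    (hnhds : 𝓝 1 ≤ map f (𝓝 1)) : Function.Surjective f := by
  set C := Subgroup.connectedComponentOfOne K with hCdef
  have hCmem : (C : Set K) ∈ 𝓝 1 :=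
    mem_of_superset hC₀ (hC₀'.subset_connectedComponent (mem_of_mem_nhds hC₀))
  have hCopen : IsOpen (C : Set K) := C.isOpen_of_mem_nhds hCmem
  have hmapopen : IsOpen ((C.map f : Subgroup K) : Set K) := by
    refine Subgroup.isOpen_of_mem_nhds _ (g := 1) (hnhds ?_)
    rw [mem_map]
    exact mem_of_superset hCmem fun x hx => ⟨x, hx, rfl⟩
  have hmapclosed : IsClosed ((C.map f : Subgroup K) : Set K) :=
    Subgroup.isClosed_of_isOpen _ hmapopen
  have hle : C ≤ C.map f := fun x hx =>
    IsClopen.connectedComponent_subset ⟨hmapclosed, hmapopen⟩ (Subgroup.one_mem _) hx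
  have hfC : C ≤ C.comap f := fun x hx => by
    have h1 : IsPreconnected (f '' (C : Set K)) :=
      (isPreconnected_connectedComponent (x := (1 : K))).image f hf.continuousOn
    exact h1.subset_connectedComponent ⟨1, C.one_mem, map_one f⟩ ⟨x, hx, rfl⟩
  have : Finite (K ⧸ C) := C.quotient_finite_of_isOpen hCopen
  let F : K ⧸ C → K ⧸ C := Quotient.map' f fun x y hxy => by
    rw [QuotientGroup.leftRel_apply] at hxy ⊢
    simpa using hfC hxy
  have hF : Function.Injective F := by
    intro p q
    induction p using QuotientGroup.induction_on with | H x => ?_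
    induction q using QuotientGroup.induction_on with | H y => ?_
    intro h
    have h1 : (f x)⁻¹ * f y ∈ C := QuotientGroup.eq.1 h
    obtain ⟨c, hc, hc'⟩ := hle h1
    rw [← map_inv, ← map_mul] at hc'
    exact QuotientGroup.eq.2 (hinj hc' ▸ hc)
  intro y
  obtain ⟨q, hq⟩ := Finite.surjective_of_injective hF (y : K ⧸ C)
  induction q using QuotientGroup.induction_on with | H x => ?_
  have h1 : (f x)⁻¹ * y ∈ C := QuotientGroup.eq.1 hq
  obtain ⟨c, hc, hc'⟩ := hle h1
  exact ⟨x * c, by rw [map_mul, hc', mul_inv_cancel_left]⟩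

end CompactGroups

/-! ### Conjugation of compact Lie subgroups. -/

namespace LCAtlas

variable {G : Type v} [Group G] [TopologicalSpace G] {𝓖 : LCAtlas.{v, w} G}

theorem IsLieGroup.isTopologicalGroup (h𝓖 : 𝓖.IsLieGroup) : IsTopologicalGroup G where
  continuous_mul := continuousOn_univ.1 h𝓖.smooth_mul.1
  continuous_inv := continuousOn_univ.1 h𝓖.smooth_inv.1

theorem IsLieGroup.conj_plot (h𝓖 : 𝓖.IsLieGroup) (a : G) {E : Type w} [AddCommGroup E] [Module ℝ E]
    [TopologicalSpace E] [IsTopologicalAddGroup E] [ContinuousSMul ℝ E] [LocallyConvexSpace ℝ E]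
    [T2Space E] {p : E → G} {O : Set E} (hp : 𝓖.IsPlot p O) :
    𝓖.IsPlot (fun x => a * p x * a⁻¹) O := by
  have hmul : ∀ {p q : E → G}, 𝓖.IsPlot p O → 𝓖.IsPlot q O → 𝓖.IsPlot (fun x => p x * q x) O :=
    fun hp hq => h𝓖.smooth_mul.comp_plot isOpen_univ
      (prod_cover h𝓖.manifold.cover h𝓖.manifold.cover) (hp.prodMk hq) (mapsTo_univ _ _)
  exact hmul (hmul (isPlot_const a hp.isOpen) hp) (isPlot_const a⁻¹ hp.isOpen)

/-- A compact submanifold is finite-dimensional. -/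
theorem finiteDimensional_of_compactSpace {A : Type u₁} [TopologicalSpace A] [T2Space A]
    [CompactSpace A] (c : LCChart.{u₁, w} A) {x : A} (hx : x ∈ c.hom.source) :
    FiniteDimensional ℝ c.Model := by
  -- A compact neighbourhood inside the chart domain maps to a compact neighbourhood in the model
  -- space, and Riesz's theorem applies.
  obtain ⟨W, hW, hWc, hWK⟩ := local_compact_nhds (c.hom.open_source.mem_nhds hx)
  have h1 : c.hom '' W ∈ 𝓝 (c.hom x) := c.hom.image_mem_nhds hx hW
  have h2 : IsCompact (c.hom '' W) := hWK.image_of_continuousOn (c.hom.continuousOn.mono hWc)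
  let : UniformSpace c.Model := IsTopologicalAddGroup.rightUniformSpace c.Model
  have : IsUniformAddGroup c.Model := isUniformAddGroup_of_addCommGroup
  exact FiniteDimensional.of_totallyBounded_nhds ℝ h1 h2.totallyBounded

theorem exists_preconnected_nhds {A : Type u₁} [TopologicalSpace A] (c : LCChart.{u₁, w} A)
    {x : A} (hx : x ∈ c.hom.source) : ∃ C ∈ 𝓝 x, IsPreconnected C := by
  obtain ⟨D, ⟨hD, hD'⟩, hDC⟩ := (LocallyConvexSpace.convex_basis (𝕜 := ℝ) (c.hom x)).mem_iff.1
    (c.hom.open_target.mem_nhds (c.hom.map_source hx))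
  refine ⟨c.hom.symm '' D, ?_, hD'.isPreconnected.image _ (c.hom.symm.continuousOn.mono hDC)⟩
  have := c.hom.symm.image_mem_nhds (c.hom.map_source hx) hD
  rwa [c.hom.left_inv hx] at this

/-- A compact Lie subgroup is not conjugate to a proper subgroup of itself. -/
theorem IsLieGroup.map_conj_eq_of_le (h𝓖 : 𝓖.IsLieGroup) {H : Subgroup G}
    (hH : 𝓖.IsSubmanifold (H : Set G)) (hHc : IsCompact (H : Set G)) (a : G)
    (ha : H.map (MulAut.conj a).toMonoidHom ≤ H) : H.map (MulAut.conj a).toMonoidHom = H := by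
  have := h𝓖.isTopologicalGroup
  have := h𝓖.manifold.t2
  have : CompactSpace H := isCompact_iff_compactSpace.1 hHc
  have hmem : ∀ h : H, a * h * a⁻¹ ∈ H := fun h => ha ⟨h, h.2, rfl⟩
  let f : H →* H :=
    { toFun := fun h => ⟨a * h * a⁻¹, hmem h⟩
      map_one' := by ext; simp
      map_mul' := fun x y => by ext; simp }
  have hfc : Continuous f := by
    refine Continuous.subtype_mk ?_ _
    fun_prop
  have hfi : Function.Injective f := fun x y hxy => by
    have := congrArg Subtype.val hxy
    simpa [f] using this
  suffices hsurj : Function.Surjective f by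
    refine le_antisymm ha fun h hh => ?_
    obtain ⟨k, hk⟩ := hsurj ⟨h, hh⟩
    exact ⟨k, k.2, congrArg Subtype.val hk⟩
  obtain ⟨φ, hφ, h1φ, K, hK, hI⟩ := hH 1 H.one_mem
  let c : LCChart (H : Set G) := φ.restrict ⟨1, H.one_mem⟩ K hI
  have h1c : (1 : H) ∈ c.hom.source := h1φ
  obtain ⟨C₀, hC₀, hC₀'⟩ := exists_preconnected_nhds c h1c
  refine surjective_of_nhds_one_le_map (K := H) hC₀ hC₀' f hfc hfi ?_
  have hfin : FiniteDimensional ℝ c.Model :=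
    finiteDimensional_of_compactSpace (A := H) c h1c
  have hcmem : c ∈ 𝓖.sub (H : Set G) := ⟨φ, _, K, hI, hφ, hK, rfl⟩
  have hcsymm : 𝓖.IsPlot (fun y => (c.hom.symm y : G)) c.hom.target :=
    isPlot_restrict_symm hφ _ K hI
  have hfplot : (𝓖.sub (H : Set G)).IsPlot (fun y => f (c.hom.symm y)) c.hom.target :=
    IsPlot.of_val h𝓖.manifold.cover (h𝓖.conj_plot a hcsymm)
  set κ : c.Model → c.Model := c.hom ∘ (fun y => f (c.hom.symm y)) with hκ
  set O : Set c.Model := c.hom.target ∩ (fun y => f (c.hom.symm y)) ⁻¹' c.hom.source with hO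
  have hOo : IsOpen O := hfplot.isOpen_inter c.hom.open_source
  have hκs : BastianiSmooth κ O := hfplot.smooth c hcmem
  obtain ⟨-, dκ, hdκ, hdκc⟩ := hκs 1
  set y₀ := c.hom (1 : H) with hy₀
  have hsy : c.hom.symm y₀ = (1 : H) := c.hom.left_inv h1c
  have hyO : y₀ ∈ O := by
    refine ⟨c.hom.map_source h1c, ?_⟩
    change f (c.hom.symm y₀) ∈ c.hom.source
    rw [hsy, map_one]
    exact h1c
  have hκy : κ y₀ = y₀ := by
    change c.hom (f (c.hom.symm y₀)) = y₀
    rw [hsy, map_one]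
  -- the inverse conjugation in the chart `φ`
  have hΛp : 𝓖.IsPlot (fun y => a⁻¹ * φ.hom.symm y * (a⁻¹)⁻¹) φ.hom.target :=
    h𝓖.conj_plot a⁻¹ hφ.isPlot_symm
  have hΛs := hφ.smooth_comp h𝓖.manifold.cover hΛp
  have hΛo := hΛp.isOpen_inter φ.hom.open_source
  obtain ⟨-, dΛ, hdΛ, hdΛc⟩ := hΛs 1
  have hval : ∀ h : H, h ∈ c.hom.source →
      Subtype.val (p := (· ∈ K)) (c.hom h) = φ.hom (h : G) := fun h hh =>
    φ.restrict_hom_apply _ K hI hh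
  -- Conjugation by `a⁻¹` undoes `κ` but is not known to preserve `H`, so it is read in the ambient
  -- chart `φ` rather than in `c`.
  have hround : ∀ y ∈ O, φ.hom (a⁻¹ * φ.hom.symm (Subtype.val (p := (· ∈ K)) (κ y)) * (a⁻¹)⁻¹) =
      Subtype.val (p := (· ∈ K)) y := by
    intro y hy
    have h1 : Subtype.val (p := (· ∈ K)) (κ y) = φ.hom (f (c.hom.symm y) : G) := hval _ hy.2
    rw [h1, φ.hom.left_inv hy.2]
    have h2 : a⁻¹ * (f (c.hom.symm y) : G) * (a⁻¹)⁻¹ = (c.hom.symm y : G) := by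
      simp [f, mul_assoc]
    rw [h2, ← hval _ (c.hom.map_target hy.1), c.hom.right_inv hy.1]
  -- If `dκ` killed `h`, the chain rule for `hround` would give the inclusion `ι` derivative zero
  -- along `h`; but that derivative is `h` itself.
  have hinj : ∀ h, dκ (y₀, h) = 0 → h = 0 := by
    intro h hh
    let ι : c.Model →L[ℝ] φ.Model := K.subtypeL
    have hι : ∀ y, ι y = Subtype.val (p := (· ∈ K)) y := fun _ => rfl
    have hg : HasDirDeriv (ι ∘ κ) y₀ h 0 := by
      have h0 := (ι.continuous.tendsto _).comp (hdκ y₀ hyO h)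
      rw [hh, map_zero] at h0
      refine h0.congr fun t => ?_
      simp
    have hιy : ι y₀ = φ.hom 1 := hval 1 h1c
    have hgy : (ι ∘ κ) y₀ = φ.hom 1 := by
      rw [Function.comp, hκy, hιy]
    have hdom : (ι ∘ κ) y₀ ∈ φ.hom.target ∩
        (fun y => a⁻¹ * φ.hom.symm y * (a⁻¹)⁻¹) ⁻¹' φ.hom.source := by
      rw [hgy]
      refine ⟨φ.hom.map_source h1φ, ?_⟩
      rw [mem_preimage, φ.hom.left_inv h1φ]
      simpa using h1φ
    have hcomp := hasDirDeriv_comp hΛo hdΛ hdΛc.continuousOn hdom hg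
    have hzero : dΛ ((ι ∘ κ) y₀, 0) = 0 := by
      have h0 := HasDirDeriv.smul (hdΛ _ hdom 0) 0
      rw [smul_zero, zero_smul] at h0
      exact HasDirDeriv.unique (hdΛ _ hdom 0) h0
    rw [hzero] at hcomp
    have hι' : HasDirDeriv ι y₀ h 0 := HasDirDeriv.congr hOo (fun y hy => hround y hy) hyO hcomp
    have hι'' : HasDirDeriv ι y₀ h (ι h) := by
      refine tendsto_const_nhds.congr' ?_
      filter_upwards [self_mem_nhdsWithin] with t ht
      have ht' : t ≠ 0 := ht
      simp [smul_smul, ht']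
    exact Subtype.val_injective (HasDirDeriv.unique hι'' hι')
  have hmap := map_nhds_eq_of_dirDeriv_injective hOo hdκ hdκc.continuousOn hyO hinj
  rw [hκy] at hmap
  have h1 : map c.hom (𝓝 (1 : H)) = 𝓝 y₀ := c.hom.map_nhds_eq h1c
  have h2 : map c.hom.symm (𝓝 y₀) = 𝓝 (1 : H) := by
    have := c.hom.symm.map_nhds_eq (c.hom.map_source h1c)
    rwa [c.hom.left_inv h1c] at this
  -- Near the identity `f` equals its chart expression, so the local openness of `κ` carries over to
  -- `f`.
  have h3 : f =ᶠ[𝓝 1] c.hom.symm ∘ κ ∘ c.hom := by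
    have hs : f ⁻¹' c.hom.source ∈ 𝓝 (1 : H) :=
      hfc.continuousAt.preimage_mem_nhds (by rw [map_one]; exact c.hom.open_source.mem_nhds h1c)
    filter_upwards [hs, c.hom.open_source.mem_nhds h1c] with x hx hx'
    change f x = c.hom.symm (c.hom (f (c.hom.symm (c.hom x))))
    rw [c.hom.left_inv hx', c.hom.left_inv hx]
  rw [map_congr h3, ← map_map, ← map_map, h1, hmap, h2]

end LCAtlas

/-! ## Local models of the orbit type pieces -/

section Pieces

variable {G : Type v} {M : Type u} [Group G] [MulAction G M]

theorem orbitType_smul (g : G) (x : M) : orbitType G (g • x) = orbitType G x :=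
  (Quotient.sound ⟨g, (MulAction.stabilizer_smul_eq_stabilizer_map_conj g x).symm⟩ :
    orbitType G x = orbitType G (g • x)).symm

/-- The inclusion of an orbit type piece into the ambient manifold. -/
def pieceIncl (X : SubMulAction G M) (σ : OccurringType X) (x : orbitTypePiece X σ) : M :=
  ((x : X) : M)

theorem pieceIncl_injective (X : SubMulAction G M) (σ : OccurringType X) :
    Function.Injective (pieceIncl X σ) :=
  Subtype.val_injective.comp Subtype.val_injective

theorem pieceIncl_isInducing [TopologicalSpace M] (X : SubMulAction G M) (σ : OccurringType X) :
    IsInducing (pieceIncl X σ) :=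
  IsInducing.subtypeVal.comp IsInducing.subtypeVal

/-- The action of `G` on an orbit type piece. -/
def pieceSMul (X : SubMulAction G M) (σ : OccurringType X) (g : G) (x : orbitTypePiece X σ) :
    orbitTypePiece X σ :=
  ⟨g • (x : X), (orbitType_smul g ((x : X) : M)).trans x.2⟩

theorem toOrbitSpace_eq_iff {X : SubMulAction G M} {x y : X} :
    toOrbitSpace X x = toOrbitSpace X y ↔ ∃ g : G, g • y = x :=
  Quotient.eq.trans (MulAction.orbitRel_apply.trans MulAction.mem_orbit_iff)

theorem pieceProjection_eq_iff {X : SubMulAction G M} {σ : OccurringType X}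
    {x y : orbitTypePiece X σ} :
    pieceProjection X σ x = pieceProjection X σ y ↔ ∃ g : G, pieceSMul X σ g y = x :=
  (Subtype.ext_iff.trans toOrbitSpace_eq_iff).trans
    (exists_congr fun _ => Subtype.ext_iff.symm)

/-- A local model of an orbit type piece `X_(H)` around the point `x`: a diffeomorphism
`(q, t) ↦ χ q • ι t` from `U × T` onto an open set `V`, where `T` is a manifold that meets every
orbit at most once. -/
structure PieceModel [TopologicalSpace M] (𝓜 : LCAtlas.{u, w} M) (X : SubMulAction G M)
    (σ : OccurringType X) (x : orbitTypePiece X σ) where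
  Q : Type v
  [topQ : TopologicalSpace Q]
  𝓠 : LCAtlas.{v, w} Q
  h𝓠 : 𝓠.IsManifold
  T : Type u
  [topT : TopologicalSpace T]
  𝓣 : LCAtlas.{u, w} T
  h𝓣 : 𝓣.IsManifold
  U : Set Q
  isOpen_U : IsOpen U
  χ : Q → G
  ι : T → orbitTypePiece X σ
  V : Set (orbitTypePiece X σ)
  isOpen_V : IsOpen V
  mem_V : x ∈ V
  j₁ : orbitTypePiece X σ → Q
  j₂ : orbitTypePiece X σ → T
  j₁_mem : ∀ y ∈ V, j₁ y ∈ U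
  continuousOn_j₁ : ContinuousOn j₁ V
  continuousOn_j₂ : ContinuousOn j₂ V
  plot_j₁ : ∀ (E : Type w) [AddCommGroup E] [Module ℝ E] [TopologicalSpace E]
    [IsTopologicalAddGroup E] [ContinuousSMul ℝ E] [LocallyConvexSpace ℝ E] [T2Space E]
    (p : E → orbitTypePiece X σ) (O : Set E), MapsTo p O V →
    𝓜.IsPlot (fun e => pieceIncl X σ (p e)) O → 𝓠.IsPlot (fun e => j₁ (p e)) O
  plot_j₂ : ∀ (E : Type w) [AddCommGroup E] [Module ℝ E] [TopologicalSpace E]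
    [IsTopologicalAddGroup E] [ContinuousSMul ℝ E] [LocallyConvexSpace ℝ E] [T2Space E]
    (p : E → orbitTypePiece X σ) (O : Set E), MapsTo p O V →
    𝓜.IsPlot (fun e => pieceIncl X σ (p e)) O → 𝓣.IsPlot (fun e => j₂ (p e)) O
  mem_of_mem : ∀ q ∈ U, ∀ t, pieceSMul X σ (χ q) (ι t) ∈ V
  j₁_apply : ∀ q ∈ U, ∀ t, j₁ (pieceSMul X σ (χ q) (ι t)) = q
  j₂_apply : ∀ q ∈ U, ∀ t, j₂ (pieceSMul X σ (χ q) (ι t)) = t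
  apply_j : ∀ y ∈ V, pieceSMul X σ (χ (j₁ y)) (ι (j₂ y)) = y
  continuousOn_apply : ContinuousOn (fun p : Q × T => pieceSMul X σ (χ p.1) (ι p.2)) (U ×ˢ univ)
  plot_apply : ∀ (E : Type w) [AddCommGroup E] [Module ℝ E] [TopologicalSpace E]
    [IsTopologicalAddGroup E] [ContinuousSMul ℝ E] [LocallyConvexSpace ℝ E] [T2Space E]
    (p : E → Q) (r : E → T) (O : Set E), MapsTo p O U → 𝓠.IsPlot p O → 𝓣.IsPlot r O →
    𝓜.IsPlot (fun e => pieceIncl X σ (pieceSMul X σ (χ (p e)) (ι (r e)))) O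
  projection_injective : Function.Injective (fun t => pieceProjection X σ (ι t))

attribute [instance] PieceModel.topQ PieceModel.topT

section

variable [TopologicalSpace G] [TopologicalSpace M] {𝓖 : LCAtlas.{v, w} G} {𝓜 : LCAtlas.{u, w} M}

theorem isCompact_stabilizer [T2Space M] (hproper : IsProperAction G M) (m : M) :
    IsCompact (MulAction.stabilizer G m : Set G) := by
  have h := (hproper {(m, m)} isCompact_singleton).image continuous_fst
  convert! h using 1
  ext g
  simp [MulAction.mem_stabilizer_iff]

/-- On the partial slice, all stabilizers agree. -/
theorem IsSlice.stabilizer_eq (h𝓖 : 𝓖.IsLieGroup) (h𝓜 : 𝓜.IsManifold)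
    (hproper : IsProperAction G M) {m : M} {S : Set M} (hS : IsSlice 𝓖 𝓜 m S) {s : M}
    (hs : s ∈ S) (hsm : orbitType G s = orbitType G m) :
    MulAction.stabilizer G s = MulAction.stabilizer G m := by
  have := h𝓜.t2
  obtain ⟨𝓠, hQ, -⟩ := hS.locally_product
  -- (SL2) gives this inclusion. Since the two stabilizers are also conjugate and `G_m` is a compact
  -- Lie subgroup, they coincide.
  have hle : MulAction.stabilizer G s ≤ MulAction.stabilizer G m := fun g hg =>
    hS.mem_stabilizer g ⟨s, hs, by rwa [MulAction.mem_stabilizer_iff.1 hg]⟩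
  obtain ⟨a, ha⟩ := Quotient.exact hsm
  have hmap : (MulAction.stabilizer G m).map (MulAut.conj a⁻¹).toMonoidHom =
      MulAction.stabilizer G s := by
    rw [← ha, Subgroup.map_map]
    ext x
    simp [Subgroup.mem_map, mul_assoc]
  have := h𝓖.map_conj_eq_of_le hQ.submanifold (isCompact_stabilizer hproper m) a⁻¹
    (by rw [hmap]; exact hle)
  rw [← hmap, this]

open Classical in
-- Acting by `χ q` changes neither orbit type nor membership in `X`, so the slice diffeomorphism `U
-- × S → V` restricts to `U × T → V ∩ X_(H)`. If `g • t' = t` with `t, t'` in `T`, then `g ∈ G_m` by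
-- (SL2), and `G_m` is the stabilizer of `t'`, so `t = t'`.
theorem IsSlice.nonempty_pieceModel (h𝓖 : 𝓖.IsLieGroup) (h𝓜 : 𝓜.IsManifold)
    (hproper : IsProperAction G M) {X : SubMulAction G M}
    {σ : OccurringType X} (x : orbitTypePiece X σ) {S : Set M}
    (hS : IsSlice 𝓖 𝓜 (pieceIncl X σ x) S)
    (hsub : ((𝓜.sub S).sub (partialSlice G (pieceIncl X σ x) S)).IsSubmanifold
      {p : partialSlice G (pieceIncl X σ x) S | ((p : S) : M) ∈ X}) :
    Nonempty (PieceModel 𝓜 X σ x) := by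
  set m := pieceIncl X σ x with hm
  have hmσ : orbitType G m = σ.1 := x.2
  obtain ⟨𝓠, hQ, U, χ, V, h1U, hUo, hχs, hχ, hmV, -, hVo, hψV, hψs, j, hjU, hjs, hjψ, hψj⟩ :=
    hS.locally_product
  have hSm := h𝓜.sub hS.submanifold
  have hPm := hSm.sub hS.partial_submanifold
  have hTm := hPm.sub hsub
  have hUo' : IsOpen (U ×ˢ (univ : Set S)) := hUo.prod isOpen_univ
  let T := {p : partialSlice G m S | ((p : S) : M) ∈ X}
  let t₀ : T := ⟨⟨⟨m, hS.mem⟩, rfl⟩, (x : X).2⟩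
  let ι : T → orbitTypePiece X σ := fun t =>
    ⟨⟨((t : partialSlice G m S) : S), t.2⟩,
      (t : partialSlice G m S).2.trans hmσ⟩
  have hι : ∀ t, pieceIncl X σ (ι t) = ((t : partialSlice G m S) : S) := fun _ => rfl
  have hj : ∀ y : orbitTypePiece X σ, pieceIncl X σ y ∈ V →
      χ (j (pieceIncl X σ y)).1 • ((j (pieceIncl X σ y)).2 : M) = pieceIncl X σ y := fun y hy =>
    hψj hy
  have hjP : ∀ y : orbitTypePiece X σ, pieceIncl X σ y ∈ V →
      (j (pieceIncl X σ y)).2 ∈ partialSlice G m S := fun y hy => by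
    change orbitType G ((j (pieceIncl X σ y)).2 : M) = orbitType G m
    rw [← orbitType_smul (χ (j (pieceIncl X σ y)).1), hj y hy, hmσ]
    exact y.2
  have hjX : ∀ y : orbitTypePiece X σ, pieceIncl X σ y ∈ V →
      ((j (pieceIncl X σ y)).2 : M) ∈ X := fun y hy => by
    have h1 : pieceIncl X σ y ∈ X := (y : X).2
    rw [← hj y hy] at h1
    simpa using X.smul_mem (χ (j (pieceIncl X σ y)).1)⁻¹ h1
  -- The value `t₀`, the centre of the slice, is only a default outside `V`.
  let j₂ : orbitTypePiece X σ → T := fun y =>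
    if hy : pieceIncl X σ y ∈ V then ⟨⟨(j (pieceIncl X σ y)).2, hjP y hy⟩, hjX y hy⟩ else t₀
  have hj₂ : ∀ y, pieceIncl X σ y ∈ V →
      ((j₂ y : partialSlice G m S) : S) = (j (pieceIncl X σ y)).2 := fun y hy => by
    simp [j₂, hy]
  have hinc := pieceIncl_isInducing X σ
  have hjc : ContinuousOn (fun y => j (pieceIncl X σ y)) (pieceIncl X σ ⁻¹' V) :=
    hjs.1.comp hinc.continuous.continuousOn fun y hy => hy
  refine ⟨⟨G ⧸ MulAction.stabilizer G m, 𝓠, hQ.quotient_manifold, T, _, hTm, U, hUo, χ, ι,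
    pieceIncl X σ ⁻¹' V, hVo.preimage hinc.continuous, hmV, fun y => (j (pieceIncl X σ y)).1, j₂,
    fun y hy => (hjU hy).1, continuous_fst.comp_continuousOn hjc, ?_, ?_, ?_, ?_, ?_, ?_, ?_, ?_,
    ?_, ?_⟩⟩
  · refine (IsInducing.subtypeVal.comp IsInducing.subtypeVal).continuousOn_iff.2 ?_
    exact (continuous_snd.comp_continuousOn hjc).congr fun y hy => hj₂ y hy
  · intro E _ _ _ _ _ _ _ p O hpV hp
    exact (hjs.comp_plot hVo h𝓜.cover hp hpV).fst hSm.cover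
  · intro E _ _ _ _ _ _ _ p O hpV hp
    have h1 := (hjs.comp_plot hVo h𝓜.cover hp hpV).snd hQ.quotient_manifold.cover
    exact ((h1.congr (g := fun e => ((j₂ (p e) : partialSlice G m S) : S))
      fun e he => (hj₂ _ (hpV he)).symm).of_val hSm.cover).of_val hPm.cover
  · intro q hq t
    exact hψV (⟨hq, trivial⟩ : (q, ((t : partialSlice G m S) : S)) ∈ U ×ˢ univ)
  · intro q hq t
    exact congrArg Prod.fst
      (hjψ (⟨hq, trivial⟩ : (q, ((t : partialSlice G m S) : S)) ∈ U ×ˢ univ))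
  · intro q hq t
    refine Subtype.ext (Subtype.ext ?_)
    rw [hj₂ (pieceSMul X σ (χ q) (ι t)) (hψV (⟨hq, trivial⟩ : (q, ((t : partialSlice G m S) : S)) ∈ U ×ˢ univ))]
    exact congrArg Prod.snd
      (hjψ (⟨hq, trivial⟩ : (q, ((t : partialSlice G m S) : S)) ∈ U ×ˢ univ))
  · intro y hy
    refine pieceIncl_injective X σ ?_
    refine Eq.trans ?_ (hj y hy)
    rw [← hj₂ y hy]
    rfl
  · refine hinc.continuousOn_iff.2 ?_
    exact hψs.1.comp (f := fun p : _ × T => (p.1, ((p.2 : partialSlice G m S) : S)))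
      (by fun_prop) fun p hp => ⟨hp.1, trivial⟩
  · intro E _ _ _ _ _ _ _ p r O hpU hp hr
    have h1 : (𝓜.sub S).IsPlot (fun e => ((r e : partialSlice G m S) : S)) O :=
      (hr.val hsub).val hS.partial_submanifold
    exact hψs.comp_plot hUo' (LCAtlas.prod_cover hQ.quotient_manifold.cover hSm.cover)
      (hp.prodMk h1) fun e he => ⟨hpU he, trivial⟩
  · intro t t' htt
    obtain ⟨g, hg⟩ := pieceProjection_eq_iff.1 htt
    have hg' : g • (((t' : partialSlice G m S) : S) : M) = ((t : partialSlice G m S) : S) :=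
      congrArg (pieceIncl X σ) hg
    have hgm : g ∈ MulAction.stabilizer G m := hS.mem_stabilizer g
      ⟨_, ((t' : partialSlice G m S) : S).2, by rw [hg']; exact ((t : partialSlice G m S) : S).2⟩
    rw [← hS.stabilizer_eq h𝓖 h𝓜 hproper ((t' : partialSlice G m S) : S).2
      (t' : partialSlice G m S).2, MulAction.mem_stabilizer_iff, hg'] at hgm
    exact Subtype.ext (Subtype.ext (Subtype.ext hgm))

end

end Pieces

/-! ## Induced and coinduced smooth structures -/

namespace LCAtlas

section

variable {E : Type w} [AddCommGroup E] [Module ℝ E] [TopologicalSpace E] [IsTopologicalAddGroup E]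
  [ContinuousSMul ℝ E] [LocallyConvexSpace ℝ E] [T2Space E]
  {M : Type u₁} {Y : Type u₂} [TopologicalSpace M] [TopologicalSpace Y] {𝓜 : LCAtlas.{u₁, w} M}
  {𝓐 : LCAtlas.{u₂, w} Y}

/-- The charts of `Y` for which `i : Y → (M, 𝓜)` is initial among smooth maps. -/
def induced (𝓜 : LCAtlas.{u₁, w} M) (i : Y → M) : LCAtlas.{u₂, w} Y :=
  {c | 𝓜.IsPlot (fun y => i (c.hom.symm y)) c.hom.target ∧
    ∀ (E : Type w) [AddCommGroup E] [Module ℝ E] [TopologicalSpace E]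
      [IsTopologicalAddGroup E] [ContinuousSMul ℝ E] [LocallyConvexSpace ℝ E] [T2Space E]
      (p : E → Y) (O : Set E), 𝓜.IsPlot (fun e => i (p e)) O →
      BastianiSmooth (c.hom ∘ p) (O ∩ p ⁻¹' c.hom.source)}

theorem IsPlot.of_induced {i : Y → M} (hi : IsInducing i) {p : E → Y} {O : Set E}
    (hp : 𝓜.IsPlot (fun e => i (p e)) O) : (𝓜.induced i).IsPlot p O :=
  ⟨hp.isOpen, hi.continuousOn_iff.2 hp.continuousOn, fun _ hc => hc.2 _ p O hp⟩

theorem IsPlot.induced {i : Y → M} (hcov : ∀ y : Y, ∃ c ∈ 𝓜.induced i, y ∈ c.hom.source)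
    {p : E → Y} {O : Set E} (hp : (𝓜.induced i).IsPlot p O) : 𝓜.IsPlot (fun e => i (p e)) O := by
  refine IsPlot.of_local hp.isOpen fun x hx => ?_
  obtain ⟨c, hc, hxc⟩ := hcov (p x)
  have hopen := hp.isOpen_inter c.hom.open_source
  refine ⟨_, hopen, ⟨hx, hxc⟩, ?_⟩
  rw [inter_eq_self_of_subset_right inter_subset_left]
  exact (hc.1.comp hopen (hp.smooth c hc) fun y hy => c.hom.map_source hy.2).congr
    fun y hy => congrArg i (c.hom.left_inv hy.2)

theorem isManifold_induced [T2Space Y] {i : Y → M}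
    (hcov : ∀ y : Y, ∃ c ∈ 𝓜.induced i, y ∈ c.hom.source) : (𝓜.induced i).IsManifold where
  t2 := inferInstance
  cover := hcov
  compatible _ hφ _ hψ := hψ.2 _ _ _ hφ.1

theorem isInducedBy_induced {i : Y → M} (hi : IsInducing i) (hinj : Function.Injective i) :
    (𝓜.induced i).IsInducedBy 𝓜 i := by
  refine ⟨hinj, smoothOn_of_plot hi.continuous.continuousOn fun φ hφ => ?_, ?_⟩
  · rw [preimage_univ, inter_univ]
    exact hφ.1
  · intro N _ 𝓒 h𝓒 f hf
    refine smoothOn_of_plot (hi.continuousOn_iff.2 hf.1) fun φ hφ => ?_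
    rw [preimage_univ, inter_univ]
    exact IsPlot.of_induced hi (hf.comp_plot isOpen_univ h𝓒.cover (h𝓒.admits hφ).isPlot_symm
      (mapsTo_univ _ _))

/-- The charts of `Z` for which `π : (Y, 𝓐) → Z` is smooth and has smooth local sections. -/
def coinduced {Z : Type u₁} [TopologicalSpace Z] (𝓐 : LCAtlas.{u₂, w} Y) (π : Y → Z) :
    LCAtlas.{u₁, w} Z :=
  {c | (∀ (E : Type w) [AddCommGroup E] [Module ℝ E] [TopologicalSpace E]
      [IsTopologicalAddGroup E] [ContinuousSMul ℝ E] [LocallyConvexSpace ℝ E] [T2Space E]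
      (p : E → Y) (O : Set E), 𝓐.IsPlot p O →
      BastianiSmooth (fun e => c.hom (π (p e))) (O ∩ p ⁻¹' (π ⁻¹' c.hom.source))) ∧
    ∀ y ∈ c.hom.target, ∃ (O : Set c.Model) (p : c.Model → Y), y ∈ O ∧ 𝓐.IsPlot p O ∧
      ∀ z ∈ O, π (p z) = c.hom.symm z}

/-- Locally `ψ ∘ φ⁻¹` is `ψ ∘ π` composed with a smooth section of `π` over the domain of `φ`, hence
smooth. -/
theorem isManifold_coinduced {Z : Type u₁} [TopologicalSpace Z] [T2Space Z] {π : Y → Z}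
    (hcov : ∀ z : Z, ∃ c ∈ 𝓐.coinduced π, z ∈ c.hom.source) : (𝓐.coinduced π).IsManifold where
  t2 := inferInstance
  cover := hcov
  compatible φ hφ ψ hψ := by
    have hopen := φ.hom.symm.isOpen_inter_preimage ψ.hom.open_source
    refine BastianiSmooth.of_local hopen fun y hy => ?_
    obtain ⟨O, p, hyO, hp, hO⟩ := hφ.2 y hy.1
    refine ⟨O, hp.isOpen, hyO, ?_⟩
    refine ((hψ.1 _ p O hp).mono ?_).congr (hopen.inter hp.isOpen) fun z hz => ?_
    · rintro z ⟨⟨-, hz⟩, hzO⟩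
      refine ⟨hzO, ?_⟩
      rw [mem_preimage, mem_preimage, hO z hzO]
      exact hz
    · rw [Function.comp, ← hO z hz.2]

end

end LCAtlas

/-! ## Charts of the pieces -/

section Pieces

variable {G : Type v} {M : Type u} [Group G] [MulAction G M] [TopologicalSpace M]
  {𝓜 : LCAtlas.{u, w} M} {X : SubMulAction G M} {σ : OccurringType X} {x : orbitTypePiece X σ}

namespace PieceModel

/-- The chart of `X_(H)` obtained from charts of the two factors of a local model. -/
def chart (P : PieceModel 𝓜 X σ x) (α : LCChart.{v, w} P.Q) (β : LCChart.{u, w} P.T) :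
    LCChart.{u, w} (orbitTypePiece X σ) where
  Model := α.Model × β.Model
  hom :=
    { toFun := fun y => (α.hom (P.j₁ y), β.hom (P.j₂ y))
      invFun := fun p => pieceSMul X σ (P.χ (α.hom.symm p.1)) (P.ι (β.hom.symm p.2))
      source := P.V ∩ (fun y => (P.j₁ y, P.j₂ y)) ⁻¹' (α.hom.source ×ˢ β.hom.source)
      target := (α.hom.target ∩ α.hom.symm ⁻¹' P.U) ×ˢ β.hom.target
      map_source' := by
        rintro y ⟨hyV, hy₁, hy₂⟩
        refine ⟨⟨α.hom.map_source hy₁, ?_⟩, β.hom.map_source hy₂⟩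
        rw [mem_preimage, α.hom.left_inv hy₁]
        exact P.j₁_mem y hyV
      map_target' := by
        rintro ⟨a, b⟩ ⟨⟨ha, haU⟩, hb⟩
        refine ⟨P.mem_of_mem _ haU _, ?_, ?_⟩
        · change P.j₁ _ ∈ α.hom.source
          rw [P.j₁_apply _ haU]
          exact α.hom.map_target ha
        · change P.j₂ _ ∈ β.hom.source
          rw [P.j₂_apply _ haU]
          exact β.hom.map_target hb
      left_inv' := by
        rintro y ⟨hyV, hy₁, hy₂⟩
        rw [α.hom.left_inv hy₁, β.hom.left_inv hy₂, P.apply_j y hyV]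
      right_inv' := by
        rintro ⟨a, b⟩ ⟨⟨ha, haU⟩, hb⟩
        refine Prod.ext ?_ ?_
        · rw [P.j₁_apply _ haU, α.hom.right_inv ha]
        · rw [P.j₂_apply _ haU, β.hom.right_inv hb]
      open_source := (P.continuousOn_j₁.prodMk P.continuousOn_j₂).isOpen_inter_preimage P.isOpen_V
        (α.hom.open_source.prod β.hom.open_source)
      open_target := (α.hom.symm.isOpen_inter_preimage P.isOpen_U).prod β.hom.open_target
      continuousOn_toFun :=
        (α.hom.continuousOn.comp (P.continuousOn_j₁.mono inter_subset_left)
          fun y hy => hy.2.1).prodMk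
        (β.hom.continuousOn.comp (P.continuousOn_j₂.mono inter_subset_left) fun y hy => hy.2.2)
      continuousOn_invFun :=
        P.continuousOn_apply.comp
          ((α.hom.symm.continuousOn.comp continuousOn_fst fun p hp => hp.1.1).prodMk
            (β.hom.symm.continuousOn.comp continuousOn_snd fun p hp => hp.2))
          fun p hp => ⟨hp.1.2, trivial⟩ }

theorem chart_mem (P : PieceModel 𝓜 X σ x) {α : LCChart.{v, w} P.Q} (hα : α ∈ P.𝓠)
    {β : LCChart.{u, w} P.T} (hβ : β ∈ P.𝓣) : P.chart α β ∈ 𝓜.induced (pieceIncl X σ) := by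
  constructor
  · have h := (P.chart α β).hom.open_target
    refine P.plot_apply (α.Model × β.Model) (fun p => α.hom.symm p.1) (fun p => β.hom.symm p.2) _
      (fun p hp => hp.1.2) ?_ ?_
    · exact (P.h𝓠.admits hα).isPlot_symm.comp h
        (bastianiSmooth_clm (ContinuousLinearMap.fst ℝ α.Model β.Model) _) fun p hp => hp.1.1
    · exact (P.h𝓣.admits hβ).isPlot_symm.comp h
        (bastianiSmooth_clm (ContinuousLinearMap.snd ℝ α.Model β.Model) _) fun p hp => hp.2
  · intro E _ _ _ _ _ _ _ p O hp
    have hpc : ContinuousOn p O := (pieceIncl_isInducing X σ).continuousOn_iff.2 hp.continuousOn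
    have hopen := hpc.isOpen_inter_preimage hp.isOpen P.isOpen_V
    have hp' := hp.mono hopen inter_subset_left
    have h₁ := P.plot_j₁ E p _ (fun e he => he.2) hp'
    have h₂ := P.plot_j₂ E p _ (fun e he => he.2) hp'
    refine (BastianiSmooth.prodMk ((h₁.smooth α hα).mono ?_) ((h₂.smooth β hβ).mono ?_))
    · exact fun e he => ⟨⟨he.1, he.2.1⟩, he.2.2.1⟩
    · exact fun e he => ⟨⟨he.1, he.2.1⟩, he.2.2.2⟩

theorem exists_chart (P : PieceModel 𝓜 X σ x) :
    ∃ c ∈ 𝓜.induced (pieceIncl X σ), x ∈ c.hom.source := by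
  obtain ⟨α, hα, h₁⟩ := P.h𝓠.cover (P.j₁ x)
  obtain ⟨β, hβ, h₂⟩ := P.h𝓣.cover (P.j₂ x)
  exact ⟨_, P.chart_mem hα hβ, P.mem_V, h₁, h₂⟩

theorem projection_ι_j₂ (P : PieceModel 𝓜 X σ x) {y : orbitTypePiece X σ} (hy : y ∈ P.V) :
    pieceProjection X σ (P.ι (P.j₂ y)) = pieceProjection X σ y :=
  (pieceProjection_eq_iff.2 ⟨_, P.apply_j y hy⟩).symm

end PieceModel

theorem isOpenQuotientMap_toOrbitSpace (hact : ∀ g : G, Continuous fun y : M => g • y) :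
    IsOpenQuotientMap (toOrbitSpace X) := by
  have : ContinuousConstSMul G X :=
    ⟨fun g => Continuous.subtype_mk ((hact g).comp continuous_subtype_val) _⟩
  exact MulAction.isOpenQuotientMap_quotientMk

theorem toOrbitSpace_preimage (σ : OccurringType X) :
    toOrbitSpace X ⁻¹' orbitSpacePiece X σ = orbitTypePiece X σ := by
  refine Subset.antisymm ?_ (subset_preimage_image _ _)
  rintro y ⟨z, hz, hzy⟩
  obtain ⟨g, rfl⟩ := toOrbitSpace_eq_iff.1 hzy
  exact (orbitType_smul g (y : M)).symm.trans hz

theorem continuous_pieceProjection (hact : ∀ g : G, Continuous fun y : M => g • y) :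
    Continuous (pieceProjection X σ) :=
  Continuous.subtype_mk
    ((isOpenQuotientMap_toOrbitSpace hact).continuous.comp continuous_subtype_val) _

/-- An open map stays open when restricted to a saturated set, and the piece is saturated by
`toOrbitSpace_preimage`. -/
theorem isOpenMap_pieceProjection (hact : ∀ g : G, Continuous fun y : M => g • y) :
    IsOpenMap (pieceProjection X σ) := by
  rintro _ ⟨A, hA, rfl⟩
  refine ⟨toOrbitSpace X '' A, (isOpenQuotientMap_toOrbitSpace hact).isOpenMap A hA, ?_⟩
  ext ⟨z, hz⟩
  constructor
  · rintro ⟨y, hy, rfl⟩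
    have hy' : y ∈ orbitTypePiece X σ := by
      rw [← toOrbitSpace_preimage]
      exact hz
    exact ⟨⟨y, hy'⟩, hy, rfl⟩
  · rintro ⟨y, hy, hyz⟩
    exact ⟨y, hy, congrArg Subtype.val hyz⟩

namespace PieceModel

theorem isOpenEmbedding_projection (P : PieceModel 𝓜 X σ x)
    (hact : ∀ g : G, Continuous fun y : M => g • y) :
    IsOpenEmbedding fun t => pieceProjection X σ (P.ι t) := by
  -- The model controls `χ q • ι t` for `q ∈ U` but not `ι` alone, so `ι t` is replaced by its
  -- translate at the fixed parameter `q = j₁ x`, which has the same projection.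
  have hq := P.j₁_mem x P.mem_V
  have hproj : ∀ t, pieceProjection X σ (pieceSMul X σ (P.χ (P.j₁ x)) (P.ι t)) =
      pieceProjection X σ (P.ι t) := fun t => pieceProjection_eq_iff.2 ⟨_, rfl⟩
  refine IsOpenEmbedding.of_continuous_injective_isOpenMap ?_ P.projection_injective ?_
  · have h1 : Continuous fun t => pieceSMul X σ (P.χ (P.j₁ x)) (P.ι t) :=
      P.continuousOn_apply.comp_continuous (f := fun t => (P.j₁ x, t)) (by fun_prop)
        fun t => ⟨hq, trivial⟩
    exact ((continuous_pieceProjection hact).comp h1).congr hproj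
  · intro W hW
    have h1 : (fun t => pieceProjection X σ (P.ι t)) '' W =
        pieceProjection X σ '' (P.V ∩ P.j₂ ⁻¹' W) := by
      ext z
      constructor
      · rintro ⟨t, ht, rfl⟩
        refine ⟨_, ⟨P.mem_of_mem _ hq t, ?_⟩, hproj t⟩
        rw [mem_preimage, P.j₂_apply _ hq]
        exact ht
      · rintro ⟨y, ⟨hyV, hy⟩, rfl⟩
        exact ⟨P.j₂ y, hy, P.projection_ι_j₂ hyV⟩
    rw [h1]
    exact isOpenMap_pieceProjection hact _
      (P.continuousOn_j₂.isOpen_inter_preimage P.isOpen_V hW)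

/-- The chart of `X_(H) / G` obtained from a chart of the transversal of a local model. -/
noncomputable def quotientChart (P : PieceModel 𝓜 X σ x)
    (hact : ∀ g : G, Continuous fun y : M => g • y) (β : LCChart.{u, w} P.T) :
    LCChart.{u, w} (orbitSpacePiece X σ) where
  Model := β.Model
  hom :=
    have : Nonempty P.T := ⟨P.j₂ x⟩
    (P.isOpenEmbedding_projection hact).toOpenPartialHomeomorph.symm.trans β.hom

theorem quotientChart_projection (P : PieceModel 𝓜 X σ x)
    (hact : ∀ g : G, Continuous fun y : M => g • y) (β : LCChart.{u, w} P.T) (t : P.T) :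
    (P.quotientChart hact β).hom (pieceProjection X σ (P.ι t)) = β.hom t := by
  have : Nonempty P.T := ⟨P.j₂ x⟩
  exact congrArg β.hom
    ((P.isOpenEmbedding_projection hact).toOpenPartialHomeomorph_left_inv _)

theorem projection_mem_quotientChart_source (P : PieceModel 𝓜 X σ x)
    (hact : ∀ g : G, Continuous fun y : M => g • y) (β : LCChart.{u, w} P.T) (t : P.T) :
    pieceProjection X σ (P.ι t) ∈ (P.quotientChart hact β).hom.source ↔ t ∈ β.hom.source := by
  have : Nonempty P.T := ⟨P.j₂ x⟩
  have h := (P.isOpenEmbedding_projection hact).toOpenPartialHomeomorph_left_inv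
    (fun t => pieceProjection X σ (P.ι t)) (x := t)
  constructor
  · rintro ⟨-, ht⟩
    rw [mem_preimage] at ht
    erw [h] at ht
    exact ht
  · intro ht
    refine ⟨(P.isOpenEmbedding_projection hact).toOpenPartialHomeomorph.map_source trivial, ?_⟩
    rw [mem_preimage]
    erw [h]
    exact ht

end PieceModel

end Pieces

/-! ### Charts of the quotient pieces and the submersion onto them. -/

section Pieces

variable {G : Type v} {M : Type u} [Group G] [MulAction G M] [TopologicalSpace M]
  {𝓜 : LCAtlas.{u, w} M} {X : SubMulAction G M} {σ : OccurringType X} {x : orbitTypePiece X σ}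

namespace PieceModel

theorem quotientChart_mem (P : PieceModel 𝓜 X σ x)
    (hact : ∀ g : G, Continuous fun y : M => g • y)
    (hplot : ∀ (g : G) (E : Type w) [AddCommGroup E] [Module ℝ E] [TopologicalSpace E]
      [IsTopologicalAddGroup E] [ContinuousSMul ℝ E] [LocallyConvexSpace ℝ E] [T2Space E]
      (p : E → M) (O : Set E), 𝓜.IsPlot p O → 𝓜.IsPlot (fun e => g • p e) O)
    (hcov : ∀ y, ∃ c ∈ 𝓜.induced (pieceIncl X σ), y ∈ c.hom.source)
    {β : LCChart.{u, w} P.T} (hβ : β ∈ P.𝓣) :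
    P.quotientChart hact β ∈ (𝓜.induced (pieceIncl X σ)).coinduced (pieceProjection X σ) := by
  have hq := P.j₁_mem x P.mem_V
  have hinc := pieceIncl_isInducing X σ
  constructor
  · intro E _ _ _ _ _ _ _ p O hp
    have hopen : IsOpen (O ∩ p ⁻¹' (pieceProjection X σ ⁻¹' (P.quotientChart hact β).hom.source)) :=
      hp.isOpen_inter
        ((P.quotientChart hact β).hom.open_source.preimage (continuous_pieceProjection hact))
    refine BastianiSmooth.of_local hopen ?_
    rintro e₀ ⟨he₀, hs⟩
    obtain ⟨t, ht⟩ : ∃ t, pieceProjection X σ (P.ι t) = pieceProjection X σ (p e₀) := by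
      have : Nonempty P.T := ⟨P.j₂ x⟩
      have h := hs.1
      rwa [OpenPartialHomeomorph.symm_symm, IsOpenEmbedding.toOpenPartialHomeomorph_target] at h
    obtain ⟨g, hg⟩ := pieceProjection_eq_iff.1 ht
    -- A plot whose projection enters the chart domain need not meet `V` itself. The factor `χ (j₁
    -- x) * g` moves `p e₀` to `χ (j₁ x) • ι t ∈ V` without changing projections, and there `j₂`
    -- computes the quotient chart.
    let p' : E → orbitTypePiece X σ := fun e => pieceSMul X σ (P.χ (P.j₁ x) * g) (p e)
    have hp' : 𝓜.IsPlot (fun e => pieceIncl X σ (p' e)) O :=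
      hplot (P.χ (P.j₁ x) * g) E _ O (hp.induced hcov)
    have hpp' : ∀ e, pieceProjection X σ (p' e) = pieceProjection X σ (p e) := fun e =>
      pieceProjection_eq_iff.2 ⟨_, rfl⟩
    have he₀' : p' e₀ = pieceSMul X σ (P.χ (P.j₁ x)) (P.ι t) := by
      rw [← hg]
      exact Subtype.ext (mul_smul _ _ _)
    have hopen' : IsOpen (O ∩ p' ⁻¹' P.V) :=
      (hinc.continuousOn_iff.2 hp'.continuousOn).isOpen_inter_preimage hp'.isOpen P.isOpen_V
    refine ⟨_, hopen', ⟨he₀, ?_⟩, ?_⟩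
    · rw [mem_preimage, he₀']
      exact P.mem_of_mem _ hq t
    · have h1 := P.plot_j₂ E p' _ (fun e he => he.2) (hp'.mono hopen' inter_subset_left)
      refine ((h1.smooth β hβ).mono ?_).congr (hopen.inter hopen') fun e he => ?_
      · rintro e ⟨⟨-, hes⟩, he⟩
        refine ⟨he, (P.projection_mem_quotientChart_source hact β _).1 ?_⟩
        rw [P.projection_ι_j₂ he.2, hpp']
        exact hes
      · rw [← hpp' e, ← P.projection_ι_j₂ he.2.2, P.quotientChart_projection hact β]
        rfl
  · intro y hy
    have hy' : y ∈ β.hom.target := hy.1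
    -- The transversal, translated by the fixed element `χ (j₁ x)`, is a smooth section over the
    -- whole chart.
    refine ⟨β.hom.target, fun z => pieceSMul X σ (P.χ (P.j₁ x)) (P.ι (β.hom.symm z)), hy', ?_, ?_⟩
    · exact LCAtlas.IsPlot.of_induced hinc (P.plot_apply _ (fun _ => P.j₁ x) (fun z => β.hom.symm z) _
        (fun _ _ => hq) (LCAtlas.isPlot_const _ β.hom.open_target) (P.h𝓣.admits hβ).isPlot_symm)
    · intro z hz
      exact pieceProjection_eq_iff.2 ⟨_, rfl⟩

theorem exists_quotientChart (P : PieceModel 𝓜 X σ x)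
    (hact : ∀ g : G, Continuous fun y : M => g • y)
    (hplot : ∀ (g : G) (E : Type w) [AddCommGroup E] [Module ℝ E] [TopologicalSpace E]
      [IsTopologicalAddGroup E] [ContinuousSMul ℝ E] [LocallyConvexSpace ℝ E] [T2Space E]
      (p : E → M) (O : Set E), 𝓜.IsPlot p O → 𝓜.IsPlot (fun e => g • p e) O)
    (hcov : ∀ y, ∃ c ∈ 𝓜.induced (pieceIncl X σ), y ∈ c.hom.source) :
    ∃ c ∈ (𝓜.induced (pieceIncl X σ)).coinduced (pieceProjection X σ),
      pieceProjection X σ x ∈ c.hom.source := by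
  obtain ⟨β, hβ, h⟩ := P.h𝓣.cover (P.j₂ x)
  refine ⟨_, P.quotientChart_mem hact hplot hcov hβ, ?_⟩
  rw [← P.projection_ι_j₂ P.mem_V]
  exact (P.projection_mem_quotientChart_source hact β _).2 h

end PieceModel

theorem isSubmersion_pieceProjection [T2Space X] [T2Space (MulAction.orbitRel.Quotient G X)]
    (hP : ∀ x : orbitTypePiece X σ, Nonempty (PieceModel 𝓜 X σ x))
    (hact : ∀ g : G, Continuous fun y : M => g • y)
    (hplot : ∀ (g : G) (E : Type w) [AddCommGroup E] [Module ℝ E] [TopologicalSpace E]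
      [IsTopologicalAddGroup E] [ContinuousSMul ℝ E] [LocallyConvexSpace ℝ E] [T2Space E]
      (p : E → M) (O : Set E), 𝓜.IsPlot p O → 𝓜.IsPlot (fun e => g • p e) O) :
    ((𝓜.induced (pieceIncl X σ)).coinduced (pieceProjection X σ)).IsManifold ∧
    (𝓜.induced (pieceIncl X σ)).IsSubmersion
      ((𝓜.induced (pieceIncl X σ)).coinduced (pieceProjection X σ)) (pieceProjection X σ) := by
  have hcov : ∀ y, ∃ c ∈ 𝓜.induced (pieceIncl X σ), y ∈ c.hom.source := fun y =>
    (hP y).some.exists_chart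
  have h𝓐 := LCAtlas.isManifold_induced hcov
  have h𝓑 : ((𝓜.induced (pieceIncl X σ)).coinduced (pieceProjection X σ)).IsManifold := by
    refine LCAtlas.isManifold_coinduced ?_
    rintro ⟨_, y, hy, rfl⟩
    exact (hP ⟨y, hy⟩).some.exists_quotientChart hact hplot hcov
  refine ⟨h𝓑, fun x => ?_⟩
  obtain ⟨P⟩ := hP x
  obtain ⟨α, hα, h₁⟩ := P.h𝓠.cover (P.j₁ x)
  obtain ⟨β, hβ, h₂⟩ := P.h𝓣.cover (P.j₂ x)
  refine ⟨P.chart α β, P.quotientChart hact β, h𝓐.admits (P.chart_mem hα hβ),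
    h𝓑.admits (P.quotientChart_mem hact hplot hcov hβ), ⟨P.mem_V, h₁, h₂⟩, ?_,
    -- In the charts `α × β` and `β` the projection forgets the `U`-coordinate.
    ContinuousLinearMap.snd ℝ α.Model β.Model, ContinuousLinearMap.inr ℝ α.Model β.Model,
    fun y => rfl, ?_⟩
  · intro y hy
    rw [← P.projection_ι_j₂ hy.1]
    exact (P.projection_mem_quotientChart_source hact β _).2 hy.2.2
  · intro y hy
    rw [← P.projection_ι_j₂ hy.1, P.quotientChart_projection hact β]
    rfl

end Pieces

/-! ## Topology of the orbit type pieces -/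

/-- The frontier condition for a family of locally closed sets follows from its first half. -/
theorem frontier_of_isLocallyClosed {Y : Type u₁} [TopologicalSpace Y] {A B : Set Y}
    (hA : IsLocallyClosed A) (hAB : (A ∩ closure B).Nonempty → A ⊆ closure B)
    (hBA : (B ∩ closure A).Nonempty → B ⊆ closure A) (hd : Disjoint A B)
    (hne : (A ∩ closure B).Nonempty) : A ⊆ closure B \ B ∧ B ∩ closure A = ∅ := by
  refine ⟨fun y hy => ⟨hAB hne hy, hd.notMem_of_mem_left hy⟩, ?_⟩
  by_contra hne'
  have hBA' := hBA (nonempty_iff_ne_empty.2 hne')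
  obtain ⟨m, hmA, hmB⟩ := hne
  -- The coborder of `A` is an open set in which `A` is closed. It contains `m ∈ closure B`, hence a
  -- point of `B`; that point lies in `closure A`, so in `A`, against disjointness.
  obtain ⟨y, hy, hyB⟩ := mem_closure_iff.1 hmB _ hA.isOpen_coborder (subset_coborder hmA)
  have hyA : y ∈ coborder A ∩ closure A := ⟨hy, hBA' hyB⟩
  rw [coborder_inter_closure] at hyA
  exact hd.notMem_of_mem_left hyA hyB

section Topology

variable {G : Type v} {M : Type u} [Group G] [TopologicalSpace G] [TopologicalSpace M]
  [MulAction G M] {𝓖 : LCAtlas.{v, w} G} {𝓜 : LCAtlas.{u, w} M}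

theorem IsSlice.exists_retraction {m : M} {S : Set M} (hS : IsSlice 𝓖 𝓜 m S) :
    ∃ (V : Set M) (r : M → S), IsOpen V ∧ m ∈ V ∧ ContinuousOn r V ∧
      ∀ y ∈ V, ∃ g : G, g • (r y : M) = y := by
  obtain ⟨𝓠, -, U, χ, V, -, -, -, -, hmV, -, hVo, -, -, j, -, hjs, -, hψj⟩ := hS.locally_product
  exact ⟨V, fun y => (j y).2, hVo, hmV, continuous_snd.comp_continuousOn hjs.1,
    fun y hy => ⟨_, hψj hy⟩⟩

variable {X : SubMulAction G M}

/-- The retraction `r` preserves orbits, so inside `V` the piece is the preimage under `r` of the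
partial slice, which is closed by (SL4). -/
theorem isLocallyClosed_orbitTypePiece (hslice : ∀ m ∈ X, ∃ S : Set M, IsSlice 𝓖 𝓜 m S)
    (σ : OccurringType X) : IsLocallyClosed (orbitTypePiece X σ) := by
  refine ((isLocallyClosed_tfae _).out 0 2).2 fun x hx => ?_
  obtain ⟨S, hS⟩ := hslice x x.2
  obtain ⟨V, r, hVo, hxV, hrc, hr⟩ := hS.exists_retraction
  refine ⟨Subtype.val ⁻¹' V, (hVo.preimage continuous_subtype_val).mem_nhds hxV, ?_⟩
  have hc : Continuous fun y : (Subtype.val ⁻¹' V : Set X) => r ((y : X) : M) :=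
    hrc.comp_continuous (by fun_prop) fun y => y.2
  convert! hS.partial_isClosed.preimage hc using 1
  ext y
  obtain ⟨g, hg⟩ := hr _ y.2
  change orbitType G ((y : X) : M) = σ.1 ↔ orbitType G (r ((y : X) : M) : M) = orbitType G (x : M)
  rw [← orbitType_smul g (r ((y : X) : M) : M), hg, hx]

/-- A point `y` near `x` lies in the orbit of `r y ∈ S`, whose stabilizer is contained in `G_x` by
(SL2). -/
theorem orbitType_le_of_mem_closure (hslice : ∀ m ∈ X, ∃ S : Set M, IsSlice 𝓖 𝓜 m S)
    {σ τ : OccurringType X} (h : (orbitTypePiece X σ ∩ closure (orbitTypePiece X τ)).Nonempty) :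
    τ.1.le σ.1 := by
  obtain ⟨x, hxσ, hxτ⟩ := h
  obtain ⟨S, hS⟩ := hslice x x.2
  obtain ⟨V, r, hVo, hxV, -, hr⟩ := hS.exists_retraction
  obtain ⟨y, hyV, hyτ⟩ := mem_closure_iff.1 hxτ _ (hVo.preimage continuous_subtype_val) hxV
  obtain ⟨g, hg⟩ := hr y hyV
  refine ⟨MulAction.stabilizer G (r y : M), MulAction.stabilizer G (x : M), ?_, hxσ, ?_⟩
  · change orbitType G (r y : M) = τ.1
    rw [← orbitType_smul g, hg]
    exact hyτ
  · exact fun k hk => hS.mem_stabilizer k ⟨_, (r y).2, by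
      rw [MulAction.mem_stabilizer_iff.1 hk]; exact (r y).2⟩

/-- Compact generation of `M × M` upgrades compactness of preimages to properness, so `(g, m) ↦ (g •
m, m)` has closed range. Restricted to `X × X`, that range is the orbit relation, and an open
quotient by a closed relation is Hausdorff. -/
theorem t2Space_orbitSpace [T2Space M] [CompactlyCoherentSpace (M × M)]
    (hact : Continuous fun p : G × M => p.1 • p.2) (hproper : IsProperAction G M) :
    T2Space (MulAction.orbitRel.Quotient G X) := by
  have hq := isOpenQuotientMap_toOrbitSpace (X := X) fun g =>
    hact.comp (Continuous.prodMk_right g)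
  refine (t2Space_iff_of_isOpenQuotientMap hq).2 ?_
  have hp : IsProperMap (fun p : G × M => (p.1 • p.2, p.2)) :=
    isProperMap_iff_isCompact_preimage.2 ⟨hact.prodMk continuous_snd, fun K hK => hproper K hK⟩
  have hc : IsClosed (range fun p : G × M => (p.1 • p.2, p.2)) := hp.isClosedMap.isClosed_range
  have hc' := hc.preimage (f := fun q : X × X => ((q.1 : M), (q.2 : M))) (by fun_prop)
  convert! hc' using 1
  ext ⟨y, z⟩
  change toOrbitSpace X y = toOrbitSpace X z ↔ _
  rw [toOrbitSpace_eq_iff]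
  constructor
  · rintro ⟨g, rfl⟩
    exact ⟨(g, z), rfl⟩
  · rintro ⟨⟨g, z'⟩, h⟩
    obtain ⟨h1, h2⟩ := Prod.ext_iff.1 h
    refine ⟨g, Subtype.ext ?_⟩
    change z' = (z : M) at h2
    subst h2
    exact h1

end Topology

/-! ### Assembly of the two stratifications. -/

theorem mainTheorem11 {G : Type v} {M : Type u} [Group G] [TopologicalSpace G]
    [TopologicalSpace M] [MulAction G M]
    (𝓖 : LCAtlas.{v, w} G) (h𝓖 : 𝓖.IsLieGroup)
    (𝓜 : LCAtlas.{u, w} M) (h𝓜 : 𝓜.IsManifold)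
    (hsmooth : IsSmoothAction 𝓖 𝓜) (hproper : IsProperAction G M)
    (X : SubMulAction G M) (hX : IsClosed (X : Set M))
    (hslice : ∀ m ∈ X, ∃ (S : Set M) (hmS : m ∈ S), IsSlice 𝓖 𝓜 m S ∧
      (IsClosed {p : partialSlice G m S | ((p : S) : M) ∈ X} ∧
        ((𝓜.sub S).sub (partialSlice G m S)).IsSubmanifold
          {p : partialSlice G m S | ((p : S) : M) ∈ X}) ∧
      ∀ τ : OccurringType X, τ.1.le (orbitType G m) →
        (⟨m, hmS⟩ : S) ∈ closure {s : S | orbitType G (s : M) = τ.1 ∧ (s : M) ∈ X}) :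
    ∃ 𝓐 : ∀ σ : OccurringType X, LCAtlas.{u, w} (orbitTypePiece X σ),
      IsStratification (orbitTypePiece X) 𝓐 ∧
      (∀ σ, (𝓐 σ).IsInducedBy 𝓜 (fun x : orbitTypePiece X σ => ((x : X) : M))) ∧
      (CompactlyCoherentSpace (M × M) →
        ∃ 𝓑 : ∀ σ : OccurringType X, LCAtlas.{u, w} (orbitSpacePiece X σ),
          IsStratification (orbitSpacePiece X) 𝓑 ∧
          ∀ σ, (𝓐 σ).IsSubmersion (𝓑 σ) (pieceProjection X σ)) := by
  have := h𝓜.t2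
  have hactc : Continuous fun p : G × M => p.1 • p.2 := continuousOn_univ.1 hsmooth.1
  have hact : ∀ g : G, Continuous fun y : M => g • y := fun g =>
    hactc.comp (Continuous.prodMk_right g)
  have hplot : ∀ (g : G) (E : Type w) [AddCommGroup E] [Module ℝ E] [TopologicalSpace E]
      [IsTopologicalAddGroup E] [ContinuousSMul ℝ E] [LocallyConvexSpace ℝ E] [T2Space E]
      (p : E → M) (O : Set E), 𝓜.IsPlot p O → 𝓜.IsPlot (fun e => g • p e) O :=
    fun g E _ _ _ _ _ _ _ p O hp => hsmooth.comp_plot isOpen_univ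
      (LCAtlas.prod_cover h𝓖.manifold.cover h𝓜.cover)
      ((LCAtlas.isPlot_const g hp.isOpen).prodMk hp) (mapsTo_univ _ _)
  have hP : ∀ (σ : OccurringType X) (x : orbitTypePiece X σ), Nonempty (PieceModel 𝓜 X σ x) :=
    fun σ x => by
      obtain ⟨S, -, hS, ⟨-, hsub⟩, -⟩ := hslice (pieceIncl X σ x) (x : X).2
      exact hS.nonempty_pieceModel h𝓖 h𝓜 hproper x hsub
  have hcov : ∀ σ, ∀ y, ∃ c ∈ 𝓜.induced (pieceIncl X σ), y ∈ c.hom.source := fun σ y =>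
    (hP σ y).some.exists_chart
  have hslice' : ∀ m ∈ X, ∃ S : Set M, IsSlice 𝓖 𝓜 m S := fun m hm =>
    let ⟨S, _, hS, _⟩ := hslice m hm
    ⟨S, hS⟩
  have hne : ∀ σ : OccurringType X, (orbitTypePiece X σ).Nonempty := fun σ =>
    let ⟨y, hy, hyσ⟩ := σ.2
    ⟨⟨y, hy⟩, hyσ⟩
  have hdisj : ∀ σ τ : OccurringType X, σ ≠ τ →
      Disjoint (orbitTypePiece X σ) (orbitTypePiece X τ) := fun σ τ hστ =>
    disjoint_left.2 fun y hσ hτ => hστ (Subtype.ext (hσ.symm.trans hτ))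
  have hcover : ∀ y : X, ∃ σ : OccurringType X, y ∈ orbitTypePiece X σ := fun y =>
    ⟨⟨_, y, y.2, rfl⟩, rfl⟩
  have hlc := isLocallyClosed_orbitTypePiece hslice'
  have hcl : ∀ σ τ : OccurringType X,
      (orbitTypePiece X σ ∩ closure (orbitTypePiece X τ)).Nonempty →
      orbitTypePiece X σ ⊆ closure (orbitTypePiece X τ) := by
    intro σ τ h y hy
    obtain ⟨S, hmS, -, -, hτ⟩ := hslice y y.2
    -- One common point already forces `τ ≤ σ`, a condition on orbit types alone; hypothesis 2 then
    -- applies at every point `y` of the piece `σ`.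
    have h1 := hτ τ (by rw [show orbitType G (y : M) = σ.1 from hy]
                        exact orbitType_le_of_mem_closure hslice' h)
    rw [closure_subtype] at h1
    rw [closure_subtype]
    refine closure_mono ?_ h1
    rintro _ ⟨s, ⟨hs, hsX⟩, rfl⟩
    exact ⟨⟨s, hsX⟩, hs, rfl⟩
  refine ⟨fun σ => 𝓜.induced (pieceIncl X σ), ⟨inferInstance, hne, hdisj,
    eq_univ_of_forall fun y => mem_iUnion.2 (hcover y), hlc,
    fun σ => LCAtlas.isManifold_induced (hcov σ), fun σ τ hd hστ =>
      frontier_of_isLocallyClosed (hlc σ) (hcl σ τ) (hcl τ σ) hd hστ⟩,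
    fun σ => LCAtlas.isInducedBy_induced (pieceIncl_isInducing X σ) (pieceIncl_injective X σ),
    fun hcc => ?_⟩
  have hT2 : T2Space (MulAction.orbitRel.Quotient G X) := t2Space_orbitSpace hactc hproper
  have hsubm := fun σ => isSubmersion_pieceProjection (hP σ) hact hplot
  have hq := isOpenQuotientMap_toOrbitSpace (X := X) hact
  have hpre := toOrbitSpace_preimage (X := X)
  have hlc' : ∀ σ, IsLocallyClosed (orbitSpacePiece X σ) := fun σ => by
    -- Coborders commute with preimages under open continuous maps, so local closedness descends to
    -- the orbit space.
    have h := hlc σ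
    rw [← hpre, isLocallyClosed_iff_isOpen_coborder,
      coborder_preimage hq.isOpenMap hq.continuous, hq.isQuotientMap.isOpen_preimage] at h
    exact isLocallyClosed_iff_isOpen_coborder.2 h
  have hcl' : ∀ σ τ : OccurringType X,
      (orbitSpacePiece X σ ∩ closure (orbitSpacePiece X τ)).Nonempty →
      orbitSpacePiece X σ ⊆ closure (orbitSpacePiece X τ) := by
    intro σ τ h
    -- Closures also commute with preimages under the open projection, so the closure relation
    -- between pieces of `X` is the preimage of the one in `X / G`.
    have h2 := hcl σ τ
    rw [← hpre, ← hpre, ← hq.isOpenMap.preimage_closure_eq_closure_preimage hq.continuous,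
      ← preimage_inter, hq.surjective.preimage_subset_preimage_iff] at h2
    exact h2 (h.preimage hq.surjective)
  refine ⟨fun σ => (𝓜.induced (pieceIncl X σ)).coinduced (pieceProjection X σ),
    ⟨hT2, fun σ => (hne σ).image _, fun σ τ hστ => ?_, ?_, hlc', fun σ => (hsubm σ).1,
      fun σ τ hd hστ =>
        frontier_of_isLocallyClosed (hlc' σ) (hcl' σ τ) (hcl' τ σ) hd hστ⟩,
    fun σ => (hsubm σ).2⟩
  · refine Disjoint.of_preimage hq.surjective ?_
    rw [hpre, hpre]
    exact hdisj σ τ hστ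
  · refine eq_univ_of_forall fun z => ?_
    obtain ⟨y, rfl⟩ := hq.surjective z
    obtain ⟨σ, hσ⟩ := hcover y
    exact mem_iUnion.2 ⟨σ, mem_image_of_mem _ hσ⟩
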